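/- Let $K$ be an integral domain of characteristic $0$ (for example $\mathbb Z$, $\mathbb Q$ or $\mathbb C$), and let $s_\lambda$ denote the Schur functions over $K$ in infinitely many variables. Let $a,b\ge 1$ and let $R=(b^a)$ be the $a\times b$ rectangular Young diagram. For a partition $\mu\subseteq R$ let $\mu^{\mathrm c}$ be its complement in $R$: the boxes of $R$ not in $\mu$, rotated by $180^\circ$. Call $\lambda\subseteq R$ self-complementary if $\lambda=\lambda^{\mathrm c}$; when $a$ and $b$ are both odd, call $\lambda\subseteq R$ almost self-complementary if $\lambda$ and $\lambda^{\mathrm c}$ differ only in which one contains the central box of $R$. Consider the family of products $s_\mu s_{\mu^{\mathrm c}}$, $\mu\subseteq R$, indexed by the unordered pairs $\{\mu,\mu^{\mathrm c}\}$. A subfamily is said to be linearly independent of all the other products if its members are linearly independent over $K$ and the $K$-span of the subfamily meets the $K$-span of all remaining products of the family only in $0$; that is, no member of the subfamily has a nonzero coefficient in any linear relation among the products. **Theorem.** 1. The squares $s_\lambda^2$, $\lambda=\lambda^{\mathrm c}$, are linearly independent of all the other products $s_\mu s_{\mu^{\mathrm c}}$, $\mu\subseteq R$. Moreover, for each self-complementary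 $\lambda$ there is a partition $\pi$ such that, for $\mu\subseteq R$, $s_\pi$ occurs with nonzero coefficient in the Schur function expansion of $s_\mu s_{\mu^{\mathrm c}}$ if and only if $\mu=\lambda$. 2. If $a$ and $b$ are both odd, the products $s_\lambda s_{\lambda^{\mathrm c}}$ with $\lambda$ almost self-complementary (one for each unordered pair $\{\lambda,\lambda^{\mathrm c}\}$) are linearly independent of all the other products $s_\mu s_{\mu^{\mathrm c}}$, $\mu\subseteq R$. Moreover, for each almost self-complementary $\lambda$ there is a partition $\pi$ such that, for $\mu\subseteq R$, $s_\pi$ occurs with nonzero coefficient in the Schur function expansion of $s_\mu s_{\mu^{\mathrm c}}$ if and only if $\{\mu,\mu^{\mathrm c}\}=\{\lambda,\lambda^{\mathrm c}\}$. -/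

import Mathlib

/-! Symmetric functions over `K` are taken inside the ring `MvPowerSeries ℕ K` of formal power
series in countably many variables; partitions are Young diagrams, with rows and columns
numbered from `0`. -/

/-- The exponent vector of the monomial `∏ x_{T(i,j)}` attached to a semistandard tableau `T`:
the number of entries of `T` equal to each value. -/
noncomputable def tableauWeight {μ : YoungDiagram} (T : SemistandardYoungTableau μ) : ℕ →₀ ℕ :=
  ∑ x ∈ μ.cells, Finsupp.single (T x.1 x.2) 1

theorem entry_mem_support_tableauWeight {μ : YoungDiagram} (T : SemistandardYoungTableau μ)
    {x : ℕ × ℕ} (hx : x ∈ μ.cells) : T x.1 x.2 ∈ (tableauWeight T).support := by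
  rw [Finsupp.mem_support_iff, tableauWeight, Finsupp.finsetSum_apply]
  have h := Finset.single_le_sum
    (f := fun y : ℕ × ℕ => (Finsupp.single (T y.1 y.2) 1 : ℕ →₀ ℕ) (T x.1 x.2))
    (fun _ _ => Nat.zero_le _) hx
  simp only [Finsupp.single_eq_same] at h
  omega

/-- Only finitely many tableaux have a given weight, so that the cardinality that defines the
coefficients of a Schur function is an honest count. -/
theorem finite_tableaux_of_weight (μ : YoungDiagram) (m : ℕ →₀ ℕ) :
    Finite {T : SemistandardYoungTableau μ // tableauWeight T = m} := by
  let f : {T : SemistandardYoungTableau μ // tableauWeight T = m} →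
      (↥μ.cells → ↥m.support) := fun T x =>
    ⟨T.1 x.1.1 x.1.2, by
      have h := entry_mem_support_tableauWeight T.1 x.2
      rwa [T.2] at h⟩
  refine Finite.of_injective f ?_
  intro S T h
  apply Subtype.ext
  apply SemistandardYoungTableau.ext
  intro i j
  by_cases hij : (i, j) ∈ μ
  · exact congrArg Subtype.val (congrFun h ⟨(i, j), hij⟩)
  · rw [S.1.zeros hij, T.1.zeros hij]

/-- The Schur function `s_μ = ∑_T x^T`, the sum over all semistandard tableaux of shape `μ`:
the coefficient of `x^m` is the number of semistandard tableaux of shape `μ` and weight `m`. -/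
noncomputable def schur (K : Type*) [CommRing K] (μ : YoungDiagram) : MvPowerSeries ℕ K :=
  fun m => (Nat.card {T : SemistandardYoungTableau μ // tableauWeight T = m} : K)

/-- The rectangular diagram with `a` rows and `b` columns. -/
def rectangle (a b : ℕ) : YoungDiagram where
  cells := Finset.range a ×ˢ Finset.range b
  isLowerSet := by
    rintro ⟨i, j⟩ ⟨i', j'⟩ ⟨hi, hj⟩ h
    simp only [Finset.coe_product, Finset.coe_range, Set.mem_prod, Set.mem_Iio] at h hi hj ⊢
    omega

/-- The complement of `μ` in the `a × b` rectangle: the boxes of the rectangle that are not in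
`μ`, rotated by 180 degrees. -/
def complement (a b : ℕ) (μ : YoungDiagram) : YoungDiagram where
  cells := (rectangle a b).cells.filter fun x => (a - 1 - x.1, b - 1 - x.2) ∉ μ
  isLowerSet := by
    rintro ⟨i, j⟩ ⟨i', j'⟩ ⟨hi, hj⟩ h
    simp only [Finset.coe_filter, Set.mem_ofPred_eq] at h hi hj ⊢
    refine ⟨(rectangle a b).isLowerSet ⟨hi, hj⟩ h.1, fun hm => h.2 ?_⟩
    exact μ.up_left_mem (by omega) (by omega) hm

/-- `μ` lies in the `a × b` rectangle and equals its complement there. -/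
def IsSelfComplementary (a b : ℕ) (μ : YoungDiagram) : Prop :=
  μ ≤ rectangle a b ∧ complement a b μ = μ

/-- `μ` lies in the `a × b` rectangle, and `μ` and its complement differ exactly in the central
box `(a / 2, b / 2)`. Used for `a` and `b` both odd. -/
def IsAlmostSelfComplementary (a b : ℕ) (μ : YoungDiagram) : Prop :=
  μ ≤ rectangle a b ∧ symmDiff μ.cells (complement a b μ).cells = {(a / 2, b / 2)}

/-- All unordered pairs `{μ, μᶜ}` with `μ` contained in the `a × b` rectangle. -/
def complementaryPairs (a b : ℕ) : Set (Sym2 YoungDiagram) :=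
  {p | ∃ μ, μ ≤ rectangle a b ∧ p = s(μ, complement a b μ)}

/-- The pairs `{μ, μᶜ}` with `μ` self-complementary. -/
def selfComplementaryPairs (a b : ℕ) : Set (Sym2 YoungDiagram) :=
  {p | ∃ μ, IsSelfComplementary a b μ ∧ p = s(μ, complement a b μ)}

/-- The pairs `{μ, μᶜ}` with `μ` almost self-complementary. -/
def almostSelfComplementaryPairs (a b : ℕ) : Set (Sym2 YoungDiagram) :=
  {p | ∃ μ, IsAlmostSelfComplementary a b μ ∧ p = s(μ, complement a b μ)}

/-- The product `s_μ s_ν` attached to an unordered pair `{μ, ν}`. -/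
noncomputable def schurProduct (K : Type*) [CommRing K] (p : Sym2 YoungDiagram) :
    MvPowerSeries ℕ K :=
  Sym2.lift ⟨fun μ ν => schur K μ * schur K ν, fun _ _ => mul_comm _ _⟩ p

/-- The members of the family `v` with index in `S` are linearly independent of the other members
with index in `P`: they are linearly independent, and no nonzero linear combination of them is a
linear combination of the others. -/
def LinearlyIndependentOfOthers (K : Type*) [CommRing K] {ι M : Type*} [AddCommGroup M]
    [Module K M] (v : ι → M) (S P : Set ι) : Prop :=
  LinearIndepOn K v S ∧
    Disjoint (Submodule.span K (v '' S)) (Submodule.span K (v '' (P \ S)))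

/-- `s_π` occurs, with nonzero coefficient, in the expansion of `f` as a finite linear combination
of Schur functions. -/
def SchurOccurs (K : Type*) [CommRing K] (π : YoungDiagram) (f : MvPowerSeries ℕ K) : Prop :=
  ∃ c : YoungDiagram →₀ K, (c.sum fun ν k => k • schur K ν) = f ∧ c π ≠ 0

/-! Let λ and κ be complementary in the a × b rectangle, with equal rows except that the middle rows
may differ in length by one. There is a diagram π such that `s_π` has coefficient one in `s_λ s_κ`
and coefficient zero in every other product of complementary Schur functions. Reading off the
coefficient of `s_π` gives both the occurrence statements and the independence statements.

The diagram π is found by peeling. Every diagram in `s_μ s_ν` has first row at most the sum of the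
first rows of μ and ν; for a diagram that attains this bound, the coefficient does not change when
the first rows of all three diagrams are deleted. The same holds for first columns. In a nonempty
rectangle other than 1 × 1, the near equality of λ and κ forces either both first rows to have
length b or both first columns to have length a. In the first case π gets a first row of length 2b:
a complementary pair whose product contains `s_π` must then have two full first rows, and deleting
them leaves a pair complementary in the (a - 2) × b rectangle. In the second case π gets a first
column of length 2a, and b drops by two. Induction on a + b ends at an empty or 1 × 1 rectangle
(`exists_separating_diagram`).

The extremal facts come from the adjoints of multiplication by the symmetric functions h_k and e_k,
which remove horizontal and vertical strips of size k. The coefficient of x₀ ^ k realizes the former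
(`headCoeff_schurMap`, from branching and Bender–Knuth symmetry) and has an evident product rule
(`headCoeff_mul`). The latter are determined by the former through the alternating relation between
the e's and the h's, and inherit the product rule (`dualCoeff_mul`). For the largest possible k the
strip can only be removed in one way, and what is left is the diagram without its first row or
column. The same peeling shows that Schur functions are linearly independent (`schurMap_injective`)
and that their products are combinations of Schur functions (`exists_schurMap_eq_mul`). -/

namespace YoungDiagram

/-! ### Row lengths, strips, and removal or insertion of a first row or column. -/

theorem ext_rowLen {μ ν : YoungDiagram} (h : ∀ i, μ.rowLen i = ν.rowLen i) : μ = ν := by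
  refine SetLike.ext fun ⟨i, j⟩ => ?_
  rw [mem_iff_lt_rowLen, mem_iff_lt_rowLen, h]

theorem le_iff_rowLen_le {μ ν : YoungDiagram} : μ ≤ ν ↔ ∀ i, μ.rowLen i ≤ ν.rowLen i := by
  constructor
  · intro h i
    by_contra! hlt
    have := h (mem_iff_lt_rowLen.2 hlt)
    exact lt_irrefl _ (mem_iff_lt_rowLen.1 this)
  · rintro h ⟨i, j⟩ hx
    exact mem_iff_lt_rowLen.2 ((mem_iff_lt_rowLen.1 hx).trans_le (h i))

theorem rowLen_pos_iff {μ : YoungDiagram} {i : ℕ} : 0 < μ.rowLen i ↔ i < μ.colLen 0 := by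
  rw [← mem_iff_lt_rowLen, mem_iff_lt_colLen]

theorem rowLen_eq_zero_iff {μ : YoungDiagram} {i : ℕ} : μ.rowLen i = 0 ↔ μ.colLen 0 ≤ i := by
  have := rowLen_pos_iff (μ := μ) (i := i)
  omega

theorem rowLen_bot (i : ℕ) : (⊥ : YoungDiagram).rowLen i = 0 := by
  by_contra h
  exact notMem_bot (i, 0) (mem_iff_lt_rowLen.2 (Nat.pos_of_ne_zero h))

/-- The Young diagram with prescribed row lengths. -/
def ofRowLenFun (f : ℕ → ℕ) (hf : Antitone f) (N : ℕ) (_hN : f N = 0) : YoungDiagram where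
  cells := (Finset.range N ×ˢ Finset.range (f 0)).filter fun x => x.2 < f x.1
  isLowerSet := by
    rintro ⟨i, j⟩ ⟨i', j'⟩ ⟨hi, hj⟩ h
    simp only [Finset.coe_filter, Finset.mem_product, Finset.mem_range, Set.mem_ofPred_eq] at h hi hj ⊢
    have := hf hi
    omega

theorem mem_ofRowLenFun {f : ℕ → ℕ} {hf : Antitone f} {N : ℕ} {hN : f N = 0} {i j : ℕ} :
    (i, j) ∈ ofRowLenFun f hf N hN ↔ j < f i := by
  rw [← mem_cells]
  simp only [ofRowLenFun, Finset.mem_filter, Finset.mem_product, Finset.mem_range]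
  refine ⟨fun h => h.2, fun h => ⟨⟨?_, h.trans_le (hf (Nat.zero_le i))⟩, h⟩⟩
  by_contra! hi
  have := hf hi
  omega

@[simp]
theorem rowLen_ofRowLenFun (f : ℕ → ℕ) (hf : Antitone f) (N : ℕ) (hN : f N = 0) (i : ℕ) :
    (ofRowLenFun f hf N hN).rowLen i = f i := by
  have h : ∀ j, j < (ofRowLenFun f hf N hN).rowLen i ↔ j < f i := fun j => by
    rw [← mem_iff_lt_rowLen, mem_ofRowLenFun]
  exact le_antisymm (not_lt.1 fun hlt => lt_irrefl _ ((h _).1 hlt))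
    (not_lt.1 fun hlt => lt_irrefl _ ((h _).2 hlt))

theorem card_eq_sum_rowLen (μ : YoungDiagram) {N : ℕ} (hN : μ.rowLen N = 0) :
    μ.card = ∑ i ∈ Finset.range N, μ.rowLen i := by
  have h : ∀ x ∈ μ.cells, x.1 ∈ Finset.range N := by
    rintro ⟨i, j⟩ hx
    have h1 := mem_iff_lt_rowLen.1 ((mem_cells _).1 hx)
    by_contra hi
    have := μ.rowLen_anti N i (by simpa using hi)
    omega
  rw [YoungDiagram.card, Finset.card_eq_sum_card_fiberwise h]
  exact Finset.sum_congr rfl fun i _ => by rw [rowLen_eq_card, row]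

theorem finite_setOf_le (μ : YoungDiagram) : {σ : YoungDiagram | σ ≤ μ}.Finite := by
  refine Set.Finite.of_finite_image (f := YoungDiagram.cells)
    ((μ.cells.powerset.finite_toSet).subset ?_) ?_
  · rintro _ ⟨σ, hσ, rfl⟩
    simpa using cells_subset_iff.2 hσ
  · intro σ _ τ _ h
    exact YoungDiagram.ext h

theorem card_le_card {μ ν : YoungDiagram} (h : μ ≤ ν) : μ.card ≤ ν.card :=
  Finset.card_le_card (cells_subset_iff.2 h)

theorem eq_of_le_of_card_eq {μ ν : YoungDiagram} (h : μ ≤ ν) (hc : μ.card = ν.card) : μ = ν :=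
  YoungDiagram.ext (Finset.eq_of_subset_of_card_le (cells_subset_iff.2 h) hc.ge)

open Classical in
/-- The diagrams `σ` such that `π / σ` is a horizontal strip of size `k`. -/
noncomputable def hStrips (k : ℕ) (π : YoungDiagram) : Finset YoungDiagram :=
  π.finite_setOf_le.toFinset.filter fun σ => (∀ i, π.rowLen (i + 1) ≤ σ.rowLen i ∧
    σ.rowLen i ≤ π.rowLen i) ∧ σ.card + k = π.card

theorem mem_hStrips {k : ℕ} {π σ : YoungDiagram} : σ ∈ hStrips k π ↔
    (∀ i, π.rowLen (i + 1) ≤ σ.rowLen i ∧ σ.rowLen i ≤ π.rowLen i) ∧ σ.card + k = π.card := by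
  simp only [hStrips, Finset.mem_filter, Set.Finite.mem_toFinset, Set.mem_ofPred_eq,
    and_iff_right_iff_imp]
  exact fun h => le_iff_rowLen_le.2 fun i => (h.1 i).2

theorem le_of_mem_hStrips {k : ℕ} {π σ : YoungDiagram} (h : σ ∈ hStrips k π) : σ ≤ π :=
  le_iff_rowLen_le.2 fun i => ((mem_hStrips.1 h).1 i).2

open Classical in
/-- The diagrams `σ` such that `π / σ` is a vertical strip of size `k`. -/
noncomputable def vStrips (k : ℕ) (π : YoungDiagram) : Finset YoungDiagram :=
  π.finite_setOf_le.toFinset.filter fun σ => (∀ i, σ.rowLen i ≤ π.rowLen i ∧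
    π.rowLen i ≤ σ.rowLen i + 1) ∧ σ.card + k = π.card

theorem mem_vStrips {k : ℕ} {π σ : YoungDiagram} : σ ∈ vStrips k π ↔
    (∀ i, σ.rowLen i ≤ π.rowLen i ∧ π.rowLen i ≤ σ.rowLen i + 1) ∧ σ.card + k = π.card := by
  simp only [vStrips, Finset.mem_filter, Set.Finite.mem_toFinset, Set.mem_ofPred_eq,
    and_iff_right_iff_imp]
  exact fun h => le_iff_rowLen_le.2 fun i => (h.1 i).1

theorem le_of_mem_vStrips {k : ℕ} {π σ : YoungDiagram} (h : σ ∈ vStrips k π) : σ ≤ π :=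
  le_iff_rowLen_le.2 fun i => ((mem_vStrips.1 h).1 i).1

theorem hStrips_zero (π : YoungDiagram) : hStrips 0 π = {π} := by
  ext σ
  rw [Finset.mem_singleton]
  constructor
  · intro h
    exact eq_of_le_of_card_eq (le_of_mem_hStrips h) (mem_hStrips.1 h).2
  · rintro rfl
    exact mem_hStrips.2 ⟨fun i => ⟨σ.rowLen_anti i (i + 1) (by omega), le_rfl⟩, rfl⟩

theorem vStrips_zero (π : YoungDiagram) : vStrips 0 π = {π} := by
  ext σ
  rw [Finset.mem_singleton]
  constructor
  · intro h
    exact eq_of_le_of_card_eq (le_of_mem_vStrips h) (mem_vStrips.1 h).2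
  · rintro rfl
    exact mem_vStrips.2 ⟨fun i => ⟨le_rfl, by omega⟩, rfl⟩

/-- The diagram without its first row. -/
def tailRows (π : YoungDiagram) : YoungDiagram :=
  ofRowLenFun (fun i => π.rowLen (i + 1)) (fun i j h => π.rowLen_anti _ _ (by omega))
    (π.colLen 0) (rowLen_eq_zero_iff.2 (by omega))

@[simp]
theorem rowLen_tailRows (π : YoungDiagram) (i : ℕ) : π.tailRows.rowLen i = π.rowLen (i + 1) :=
  rowLen_ofRowLenFun _ _ _ _ i

/-- The diagram without its first column. -/
def tailCols (π : YoungDiagram) : YoungDiagram :=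
  ofRowLenFun (fun i => π.rowLen i - 1) (fun i j h => by
      have := π.rowLen_anti _ _ h
      dsimp only
      omega)
    (π.colLen 0) (by rw [rowLen_eq_zero_iff.2 le_rfl])

@[simp]
theorem rowLen_tailCols (π : YoungDiagram) (i : ℕ) : π.tailCols.rowLen i = π.rowLen i - 1 :=
  rowLen_ofRowLenFun _ _ _ _ i

theorem card_tailRows (π : YoungDiagram) : π.tailRows.card + π.rowLen 0 = π.card := by
  have h0 : π.rowLen (π.colLen 0 + 1) = 0 := rowLen_eq_zero_iff.2 (by omega)
  rw [card_eq_sum_rowLen π h0, card_eq_sum_rowLen (N := π.colLen 0) _ (by simpa using h0),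
    Finset.sum_range_succ']
  simp

theorem card_tailCols (π : YoungDiagram) : π.tailCols.card + π.colLen 0 = π.card := by
  have h0 : π.rowLen (π.colLen 0) = 0 := rowLen_eq_zero_iff.2 le_rfl
  rw [card_eq_sum_rowLen π h0, card_eq_sum_rowLen (N := π.colLen 0) _ (by simp [h0])]
  have : ∑ i ∈ Finset.range (π.colLen 0), π.rowLen i =
      ∑ i ∈ Finset.range (π.colLen 0), (π.tailCols.rowLen i + 1) :=
    Finset.sum_congr rfl fun i hi => by
      have := rowLen_pos_iff.2 (Finset.mem_range.1 hi)
      rw [rowLen_tailCols]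
      omega
  rw [this, Finset.sum_add_distrib]
  simp

/-- This bounds a horizontal strip by the length of the first row, and at that size leaves
`tailRows` as the only possible remainder. Hence the largest strip operator peels off the first row.
-/
theorem tailRows_le_of_mem_hStrips {k : ℕ} {π σ : YoungDiagram} (h : σ ∈ hStrips k π) :
    π.tailRows ≤ σ :=
  le_iff_rowLen_le.2 fun i => by simpa using ((mem_hStrips.1 h).1 i).1

theorem tailCols_le_of_mem_vStrips {k : ℕ} {π σ : YoungDiagram} (h : σ ∈ vStrips k π) :
    π.tailCols ≤ σ :=
  le_iff_rowLen_le.2 fun i => by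
    have := ((mem_vStrips.1 h).1 i).2
    rw [rowLen_tailCols]
    omega

theorem hStrips_eq_empty {k : ℕ} {π : YoungDiagram} (h : π.rowLen 0 < k) : hStrips k π = ∅ := by
  refine Finset.eq_empty_of_forall_notMem fun σ hσ => ?_
  have h1 := card_le_card (tailRows_le_of_mem_hStrips hσ)
  have h2 := (mem_hStrips.1 hσ).2
  have h3 := π.card_tailRows
  omega

theorem vStrips_eq_empty {k : ℕ} {π : YoungDiagram} (h : π.colLen 0 < k) : vStrips k π = ∅ := by
  refine Finset.eq_empty_of_forall_notMem fun σ hσ => ?_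
  have h1 := card_le_card (tailCols_le_of_mem_vStrips hσ)
  have h2 := (mem_vStrips.1 hσ).2
  have h3 := π.card_tailCols
  omega

theorem hStrips_rowLen_zero (π : YoungDiagram) : hStrips (π.rowLen 0) π = {π.tailRows} := by
  ext σ
  rw [Finset.mem_singleton]
  constructor
  · intro h
    have h2 := (mem_hStrips.1 h).2
    have h3 := π.card_tailRows
    exact (eq_of_le_of_card_eq (tailRows_le_of_mem_hStrips h) (by omega)).symm
  · rintro rfl
    refine mem_hStrips.2 ⟨fun i => ?_, π.card_tailRows⟩
    rw [rowLen_tailRows]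
    exact ⟨le_rfl, π.rowLen_anti i (i + 1) (by omega)⟩

theorem vStrips_colLen_zero (π : YoungDiagram) : vStrips (π.colLen 0) π = {π.tailCols} := by
  ext σ
  rw [Finset.mem_singleton]
  constructor
  · intro h
    have h2 := (mem_vStrips.1 h).2
    have h3 := π.card_tailCols
    exact (eq_of_le_of_card_eq (tailCols_le_of_mem_vStrips h) (by omega)).symm
  · rintro rfl
    refine mem_vStrips.2 ⟨fun i => ?_, π.card_tailCols⟩
    rw [rowLen_tailCols]
    omega

theorem eq_of_tailRows_eq {π σ : YoungDiagram} (h0 : π.rowLen 0 = σ.rowLen 0)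
    (h : π.tailRows = σ.tailRows) : π = σ :=
  ext_rowLen fun i => by
    cases i with
    | zero => exact h0
    | succ i => rw [← rowLen_tailRows, h, rowLen_tailRows]

theorem eq_of_tailCols_eq {π σ : YoungDiagram} (h0 : π.colLen 0 = σ.colLen 0)
    (h : π.tailCols = σ.tailCols) : π = σ :=
  ext_rowLen fun i => by
    have h1 := rowLen_pos_iff (μ := π) (i := i)
    have h2 := rowLen_pos_iff (μ := σ) (i := i)
    have h3 : π.rowLen i - 1 = σ.rowLen i - 1 := by
      rw [← rowLen_tailCols, h, rowLen_tailCols]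
    omega

/-- The diagram with a new first row of length `p`. -/
def consRow (p : ℕ) (π : YoungDiagram) (h : π.rowLen 0 ≤ p) : YoungDiagram :=
  ofRowLenFun (fun i => Nat.casesOn i p π.rowLen) (antitone_nat_of_succ_le fun i => by
      cases i with
      | zero => exact h
      | succ i => exact π.rowLen_anti _ _ (by omega))
    (π.colLen 0 + 1) (rowLen_eq_zero_iff.2 le_rfl)

@[simp]
theorem rowLen_zero_consRow {p : ℕ} {π : YoungDiagram} (h : π.rowLen 0 ≤ p) :
    (consRow p π h).rowLen 0 = p := by
  simp [consRow]

@[simp]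
theorem rowLen_succ_consRow {p : ℕ} {π : YoungDiagram} (h : π.rowLen 0 ≤ p) (i : ℕ) :
    (consRow p π h).rowLen (i + 1) = π.rowLen i := by
  simp [consRow]

@[simp]
theorem tailRows_consRow {p : ℕ} {π : YoungDiagram} (h : π.rowLen 0 ≤ p) :
    (consRow p π h).tailRows = π :=
  ext_rowLen fun i => by simp

/-- The diagram with a new first column of length `p`. -/
def consCol (p : ℕ) (π : YoungDiagram) (_h : π.colLen 0 ≤ p) : YoungDiagram :=
  ofRowLenFun (fun i => if i < p then π.rowLen i + 1 else 0) (fun i j hij => by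
      have := π.rowLen_anti _ _ hij
      dsimp only
      split_ifs <;> omega)
    p (by simp)

theorem rowLen_consCol {p : ℕ} {π : YoungDiagram} (h : π.colLen 0 ≤ p) (i : ℕ) :
    (consCol p π h).rowLen i = if i < p then π.rowLen i + 1 else 0 :=
  rowLen_ofRowLenFun _ _ _ _ i

theorem colLen_zero_consCol {p : ℕ} {π : YoungDiagram} (h : π.colLen 0 ≤ p) :
    (consCol p π h).colLen 0 = p := by
  have h1 : ∀ i, i < (consCol p π h).colLen 0 ↔ i < p := fun i => by
    rw [← rowLen_pos_iff, rowLen_consCol]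
    split_ifs <;> simp_all
  exact le_antisymm (not_lt.1 fun hlt => lt_irrefl _ ((h1 _).1 hlt))
    (not_lt.1 fun hlt => lt_irrefl _ ((h1 _).2 hlt))

@[simp]
theorem tailCols_consCol {p : ℕ} {π : YoungDiagram} (h : π.colLen 0 ≤ p) :
    (consCol p π h).tailCols = π :=
  ext_rowLen fun i => by
    rw [rowLen_tailCols, rowLen_consCol]
    split_ifs with hi
    · rfl
    · have : π.rowLen i = 0 := rowLen_eq_zero_iff.2 (by omega)
      omega

end YoungDiagram

/-! ### Branching: removal of the largest value from a tableau. -/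

namespace SemistandardYoungTableau

open YoungDiagram

theorem entry_lt_of_tableauWeight {μ : YoungDiagram} (T : SemistandardYoungTableau μ) {n : ℕ}
    (h : ∀ k, n ≤ k → tableauWeight T k = 0) {i j : ℕ} (hx : (i, j) ∈ μ) : T i j < n := by
  by_contra! hn
  exact Finsupp.mem_support_iff.1
    (entry_mem_support_tableauWeight T ((mem_cells _).2 hx)) (h _ hn)

theorem tableauWeight_eq_zero_of_forall_lt {μ : YoungDiagram} (T : SemistandardYoungTableau μ)
    {n : ℕ} (h : ∀ i j, (i, j) ∈ μ → T i j < n) {k : ℕ} (hk : n ≤ k) :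
    tableauWeight T k = 0 := by
  rw [tableauWeight, Finsupp.finsetSum_apply]
  refine Finset.sum_eq_zero fun x hx => ?_
  have := h x.1 x.2 ((mem_cells _).1 hx)
  rw [Finsupp.single_apply, if_neg (by omega)]

/-- The cells of a tableau with entries less than `n`. -/
def shapeLT {μ : YoungDiagram} (T : SemistandardYoungTableau μ) (n : ℕ) : YoungDiagram where
  cells := μ.cells.filter fun x => T x.1 x.2 < n
  isLowerSet := by
    rintro ⟨i, j⟩ ⟨i', j'⟩ ⟨hi, hj⟩ h
    simp only [Finset.coe_filter, Set.mem_ofPred_eq, mem_cells] at h hi hj ⊢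
    refine ⟨μ.up_left_mem hi hj h.1, ?_⟩
    have h1 := T.row_weak_of_le hj h.1
    have h2 := T.col_weak hi (μ.up_left_mem le_rfl hj h.1)
    omega

theorem mem_shapeLT {μ : YoungDiagram} {T : SemistandardYoungTableau μ} {n i j : ℕ} :
    (i, j) ∈ T.shapeLT n ↔ (i, j) ∈ μ ∧ T i j < n := by
  rw [← mem_cells]
  simp [shapeLT]

/-- The tableau formed by the entries less than `n`. -/
def restrictLT {μ : YoungDiagram} (T : SemistandardYoungTableau μ) (n : ℕ) :
    SemistandardYoungTableau (T.shapeLT n) where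
  entry i j := if (i, j) ∈ T.shapeLT n then T i j else 0
  row_weak' {i j1 j2} hj h := by
    rw [if_pos h, if_pos ((T.shapeLT n).up_left_mem le_rfl hj.le h)]
    exact T.row_weak hj (mem_shapeLT.1 h).1
  col_strict' {i1 i2 j} hi h := by
    rw [if_pos h, if_pos ((T.shapeLT n).up_left_mem hi.le le_rfl h)]
    exact T.col_strict hi (mem_shapeLT.1 h).1
  zeros' h := if_neg h

theorem restrictLT_apply {μ : YoungDiagram} (T : SemistandardYoungTableau μ) (n i j : ℕ) :
    T.restrictLT n i j = if (i, j) ∈ T.shapeLT n then T i j else 0 :=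
  rfl

/-- The tableau obtained by filling a horizontal strip with the entry `n`. -/
def fillStrip {π σ : YoungDiagram} (n : ℕ) (hs : ∀ i, π.rowLen (i + 1) ≤ σ.rowLen i)
    (T : SemistandardYoungTableau σ) (hT : ∀ i j, (i, j) ∈ σ → T i j < n) :
    SemistandardYoungTableau π where
  entry i j := if (i, j) ∈ π then if (i, j) ∈ σ then T i j else n else 0
  row_weak' {i j1 j2} hj h := by
    rw [if_pos h, if_pos (π.up_left_mem le_rfl hj.le h)]
    by_cases h2 : (i, j2) ∈ σ
    · rw [if_pos h2, if_pos (σ.up_left_mem le_rfl hj.le h2)]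
      exact T.row_weak hj h2
    · rw [if_neg h2]
      split_ifs with h1
      · exact (hT _ _ h1).le
      · exact le_rfl
  col_strict' {i1 i2 j} hi h := by
    have h1 : (i1, j) ∈ σ := mem_iff_lt_rowLen.2 <|
      ((mem_iff_lt_rowLen.1 h).trans_le (π.rowLen_anti (i1 + 1) i2 hi)).trans_le (hs i1)
    rw [if_pos h, if_pos (π.up_left_mem hi.le le_rfl h), if_pos h1]
    split_ifs with h2
    · exact T.col_strict hi h2
    · exact hT _ _ h1
  zeros' h := if_neg h

theorem fillStrip_apply {π σ : YoungDiagram} {n : ℕ} (hs : ∀ i, π.rowLen (i + 1) ≤ σ.rowLen i)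
    (T : SemistandardYoungTableau σ) (hT : ∀ i j, (i, j) ∈ σ → T i j < n) (i j : ℕ) :
    fillStrip n hs T hT i j = if (i, j) ∈ π then if (i, j) ∈ σ then T i j else n else 0 :=
  rfl

theorem tableauWeight_eq_add_single {π σ : YoungDiagram} {n : ℕ} (hσ : σ ≤ π)
    (T : SemistandardYoungTableau π) (U : SemistandardYoungTableau σ)
    (hU : ∀ i j, (i, j) ∈ σ → T i j = U i j)
    (hn : ∀ i j, (i, j) ∈ π → (i, j) ∉ σ → T i j = n) :
    tableauWeight T = tableauWeight U + Finsupp.single n (π.card - σ.card) := by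
  have hsub := cells_subset_iff.2 hσ
  rw [tableauWeight, tableauWeight, ← Finset.sum_sdiff hsub, add_comm]
  congr 1
  · exact Finset.sum_congr rfl fun x hx => by rw [hU _ _ ((mem_cells _).1 hx)]
  · rw [Finset.sum_congr rfl (g := fun _ => Finsupp.single n 1) fun x hx => by
      rw [Finset.mem_sdiff, mem_cells, mem_cells] at hx
      rw [hn _ _ hx.1 hx.2], Finset.sum_const, Finset.card_sdiff_of_subset hsub]
    simp

theorem shapeLT_le {μ : YoungDiagram} (T : SemistandardYoungTableau μ) (n : ℕ) :
    T.shapeLT n ≤ μ :=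
  fun ⟨_, _⟩ h => (mem_shapeLT.1 h).1

theorem tableauWeight_eq_restrictLT_add {μ : YoungDiagram} (T : SemistandardYoungTableau μ)
    {n : ℕ} (h : ∀ k, n + 1 ≤ k → tableauWeight T k = 0) :
    tableauWeight T =
      tableauWeight (T.restrictLT n) + Finsupp.single n (μ.card - (T.shapeLT n).card) := by
  refine tableauWeight_eq_add_single (T.shapeLT_le n) T _ (fun i j hx => ?_) fun i j hx hx' => ?_
  · rw [restrictLT_apply, if_pos hx]
  · have h1 := T.entry_lt_of_tableauWeight h hx
    have h2 : ¬ T i j < n := fun h' => hx' (mem_shapeLT.2 ⟨hx, h'⟩)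
    omega

theorem tableauWeight_restrictLT {μ : YoungDiagram} (T : SemistandardYoungTableau μ)
    {n : ℕ} (h : ∀ k, n + 1 ≤ k → tableauWeight T k = 0) :
    tableauWeight (T.restrictLT n) = (tableauWeight T).erase n := by
  have h0 : tableauWeight (T.restrictLT n) n = 0 :=
    tableauWeight_eq_zero_of_forall_lt _ (fun i j hx => by
      rw [restrictLT_apply, if_pos hx]
      exact (mem_shapeLT.1 hx).2) le_rfl
  rw [T.tableauWeight_eq_restrictLT_add h, Finsupp.erase_add, Finsupp.erase_single, add_zero,
    Finsupp.erase_of_notMem_support (by simpa using h0)]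

theorem shapeLT_mem_hStrips {μ : YoungDiagram} (T : SemistandardYoungTableau μ)
    {n : ℕ} (h : ∀ k, n + 1 ≤ k → tableauWeight T k = 0) :
    T.shapeLT n ∈ hStrips (tableauWeight T n) μ := by
  have hle := T.shapeLT_le n
  refine mem_hStrips.2 ⟨fun i => ⟨?_, le_iff_rowLen_le.1 hle i⟩, ?_⟩
  · by_contra! hlt
    have h1 : (i + 1, (T.shapeLT n).rowLen i) ∈ μ := mem_iff_lt_rowLen.2 hlt
    have h2 := T.col_strict (Nat.lt_add_one i) h1
    have h3 := T.entry_lt_of_tableauWeight h h1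
    have h4 : (i, (T.shapeLT n).rowLen i) ∈ T.shapeLT n :=
      mem_shapeLT.2 ⟨μ.up_left_mem (Nat.le_succ i) le_rfl h1, by omega⟩
    exact lt_irrefl _ (mem_iff_lt_rowLen.1 h4)
  · have h1 := T.tableauWeight_eq_restrictLT_add h
    have h2 := T.tableauWeight_restrictLT h
    rw [h2] at h1
    have h3 := DFunLike.congr_fun h1 n
    simp only [Finsupp.add_apply, Finsupp.erase_same, Finsupp.single_eq_same, zero_add] at h3
    have := card_le_card hle
    omega

/-- Filling the strip π / σ with the value `n` is inverse to restricting a tableau to its entries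
below `n`. -/
theorem card_shapeLT_eq {π σ : YoungDiagram} {m : ℕ →₀ ℕ} {n : ℕ}
    (hm : ∀ k, n + 1 ≤ k → m k = 0) (hσ : σ ∈ hStrips (m n) π) :
    Nat.card {T : {T : SemistandardYoungTableau π // tableauWeight T = m} // T.1.shapeLT n = σ} =
      Nat.card {T : SemistandardYoungTableau σ // tableauWeight T = m.erase n} := by
  have hle := le_of_mem_hStrips hσ
  have hs := fun i => ((mem_hStrips.1 hσ).1 i).1
  have hk : ∀ k, n ≤ k → m.erase n k = 0 := fun k hk => by
    rcases eq_or_ne k n with rfl | hne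
    · simp
    · rw [Finsupp.erase_ne hne]
      exact hm k (by omega)
  have hlt : ∀ T : {T : SemistandardYoungTableau σ // tableauWeight T = m.erase n},
      ∀ i j, (i, j) ∈ σ → T.1 i j < n := fun T i j hx =>
    T.1.entry_lt_of_tableauWeight (by rw [T.2]; exact hk) hx
  have hsh : ∀ T : {T : SemistandardYoungTableau σ // tableauWeight T = m.erase n},
      (fillStrip n hs T.1 (hlt T)).shapeLT n = σ := fun T => by
    refine SetLike.ext fun ⟨i, j⟩ => ?_
    rw [mem_shapeLT, fillStrip_apply]
    constructor
    · rintro ⟨h1, h2⟩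
      rw [if_pos h1] at h2
      by_contra h
      rw [if_neg h] at h2
      exact lt_irrefl _ h2
    · intro h
      rw [if_pos (hle h), if_pos h]
      exact ⟨hle h, hlt T i j h⟩
  have hwt : ∀ T : {T : SemistandardYoungTableau σ // tableauWeight T = m.erase n},
      tableauWeight (fillStrip n hs T.1 (hlt T)) = m := fun T => by
    rw [tableauWeight_eq_add_single hle (fillStrip n hs T.1 (hlt T)) T.1
      (fun i j h => by rw [fillStrip_apply, if_pos (hle h), if_pos h])
      (fun i j h h' => by rw [fillStrip_apply, if_pos h, if_neg h']), T.2]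
    have := (mem_hStrips.1 hσ).2
    rw [show π.card - σ.card = m n by omega, Finsupp.erase_add_single]
  refine (Nat.card_congr (Equiv.ofBijective
    (fun T => ⟨⟨fillStrip n hs T.1 (hlt T), hwt T⟩, hsh T⟩)
    ⟨?_, ?_⟩)).symm
  · intro T U h
    have h1 := congrArg (fun V => V.1.1) h
    refine Subtype.ext (SemistandardYoungTableau.ext fun i j => ?_)
    by_cases hx : (i, j) ∈ σ
    · have h2 := congrFun (congrFun (congrArg DFunLike.coe h1) i) j
      dsimp only at h2
      rwa [fillStrip_apply, fillStrip_apply, if_pos (hle hx), if_pos (hle hx), if_pos hx,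
        if_pos hx] at h2
    · rw [T.1.zeros hx, U.1.zeros hx]
  · rintro ⟨⟨T, rfl⟩, rfl⟩
    refine ⟨⟨T.restrictLT n, T.tableauWeight_restrictLT hm⟩, ?_⟩
    refine Subtype.ext (Subtype.ext (SemistandardYoungTableau.ext fun i j => ?_))
    dsimp only
    rw [fillStrip_apply, restrictLT_apply]
    split_ifs with h1 h2
    · rfl
    · have h3 := T.entry_lt_of_tableauWeight hm h1
      have h4 : ¬ T i j < n := fun h' => h2 (mem_shapeLT.2 ⟨h1, h'⟩)
      omega
    · rw [T.zeros h1]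

/-- The tableaux are sorted by the shape of their entries below `n`, the largest value allowed; the
boxes with value `n` form a horizontal strip of size `m n`. -/
theorem card_tableaux_eq_sum (π : YoungDiagram) {m : ℕ →₀ ℕ} {n : ℕ}
    (hm : ∀ k, n + 1 ≤ k → m k = 0) :
    Nat.card {T : SemistandardYoungTableau π // tableauWeight T = m} =
      ∑ σ ∈ hStrips (m n) π,
        Nat.card {T : SemistandardYoungTableau σ // tableauWeight T = m.erase n} := by
  have := finite_tableaux_of_weight π m
  have e := Equiv.sigmaFiberEquiv
    (fun T : {T : SemistandardYoungTableau π // tableauWeight T = m} =>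
      (⟨T.1.shapeLT n, by
        have := T.1.shapeLT_mem_hStrips (n := n) (by rw [T.2]; exact hm)
        rwa [T.2] at this⟩ : {σ // σ ∈ hStrips (m n) π}))
  rw [← Nat.card_congr e, Nat.card_sigma, ← Finset.sum_coe_sort (hStrips (m n) π)]
  refine Finset.sum_congr rfl fun σ _ => ?_
  rw [← card_shapeLT_eq hm σ.2]
  exact Nat.card_congr (Equiv.subtypeEquivRight fun T => Subtype.ext_iff)

theorem card_tableaux_zero (π : YoungDiagram) [Decidable (π = ⊥)] :
    Nat.card {T : SemistandardYoungTableau π // tableauWeight T = 0} = if π = ⊥ then 1 else 0 := by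
  split_ifs with h
  · subst h
    rw [Nat.card_eq_one_iff_unique]
    refine ⟨⟨fun T U => Subtype.ext (SemistandardYoungTableau.ext fun i j => ?_)⟩,
      ⟨default, by simp [tableauWeight]⟩⟩
    rw [T.1.zeros (notMem_bot _), U.1.zeros (notMem_bot _)]
  · rw [Nat.card_eq_zero]
    refine Or.inl ⟨fun T => h (le_bot_iff.1 fun ⟨i, j⟩ hx => ?_)⟩
    exact absurd (T.1.entry_lt_of_tableauWeight (n := 0) (by simp [T.2]) hx) (Nat.not_lt_zero _)

end SemistandardYoungTableau

/-! ### Two involutions: the Bender–Knuth reflection and the toggle of one row. -/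

namespace YoungDiagram

/-- The least possible length of row `i` of a diagram between `ρ` and `π` such that both
differences are horizontal strips. -/
def interlaceLower (π ρ : YoungDiagram) (i : ℕ) : ℕ := max (ρ.rowLen i) (π.rowLen (i + 1))

/-- The greatest possible length of row `i` of a diagram between `ρ` and `π` such that both
differences are horizontal strips. -/
def interlaceUpper (π ρ : YoungDiagram) : ℕ → ℕ
  | 0 => π.rowLen 0
  | i + 1 => min (ρ.rowLen i) (π.rowLen (i + 1))

/-- The intervals allowed for consecutive rows meet at most in an endpoint, so each row can be moved
within its interval independently of the others. -/
theorem interlaceUpper_succ_le (π ρ : YoungDiagram) (i : ℕ) :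
    interlaceUpper π ρ (i + 1) ≤ interlaceLower π ρ i := by
  simp only [interlaceUpper, interlaceLower]
  omega

theorem interlaceUpper_le (π ρ : YoungDiagram) (i : ℕ) : interlaceUpper π ρ i ≤ π.rowLen i := by
  cases i with
  | zero => exact le_rfl
  | succ i => exact min_le_right _ _

theorem mem_hStrips_and_mem_hStrips {p q : ℕ} {π σ ρ : YoungDiagram} :
    σ ∈ hStrips q π ∧ ρ ∈ hStrips p σ ↔
      (∀ i, interlaceLower π ρ i ≤ σ.rowLen i ∧ σ.rowLen i ≤ interlaceUpper π ρ i) ∧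
        σ.card + q = π.card ∧ ρ.card + p = σ.card := by
  rw [mem_hStrips, mem_hStrips]
  constructor
  · rintro ⟨⟨h1, h2⟩, h3, h4⟩
    refine ⟨fun i => ⟨max_le (h3 i).2 (h1 i).1, ?_⟩, h2, h4⟩
    cases i with
    | zero => exact (h1 0).2
    | succ i => exact le_min (h3 i).1 (h1 (i + 1)).2
  · rintro ⟨h1, h2, h3⟩
    refine ⟨⟨fun i => ⟨(le_max_right _ _).trans (h1 i).1,
      (h1 i).2.trans (interlaceUpper_le π ρ i)⟩, h2⟩, fun i => ⟨?_, (le_max_left _ _).trans (h1 i).1⟩, h3⟩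
    exact (h1 (i + 1)).2.trans (min_le_left _ _)

/-- The Bender–Knuth reflection of `σ` in the interval of diagrams interlacing `ρ` and `π`. -/
def bkReflect (π ρ σ : YoungDiagram)
    (h : ∀ i, interlaceLower π ρ i ≤ σ.rowLen i ∧ σ.rowLen i ≤ interlaceUpper π ρ i) :
    YoungDiagram :=
  ofRowLenFun (fun i => interlaceLower π ρ i + interlaceUpper π ρ i - σ.rowLen i)
    (antitone_nat_of_succ_le fun i => by
      have h1 := interlaceUpper_succ_le π ρ i
      have h2 := h i
      have h3 := h (i + 1)
      omega)
    (π.colLen 0) (by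
      have h0 : π.rowLen (π.colLen 0) = 0 := rowLen_eq_zero_iff.2 le_rfl
      have h1 := interlaceUpper_le π ρ (π.colLen 0)
      have h2 := h (π.colLen 0)
      omega)

theorem rowLen_bkReflect (π ρ σ : YoungDiagram)
    (h : ∀ i, interlaceLower π ρ i ≤ σ.rowLen i ∧ σ.rowLen i ≤ interlaceUpper π ρ i) (i : ℕ) :
    (bkReflect π ρ σ h).rowLen i = interlaceLower π ρ i + interlaceUpper π ρ i - σ.rowLen i :=
  rowLen_ofRowLenFun _ _ _ _ i

theorem bkReflect_mem (π ρ σ : YoungDiagram)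
    (h : ∀ i, interlaceLower π ρ i ≤ σ.rowLen i ∧ σ.rowLen i ≤ interlaceUpper π ρ i) (i : ℕ) :
    interlaceLower π ρ i ≤ (bkReflect π ρ σ h).rowLen i ∧
      (bkReflect π ρ σ h).rowLen i ≤ interlaceUpper π ρ i := by
  have := h i
  rw [rowLen_bkReflect]
  omega

/-- Lower bound `i` and upper bound `i + 1` are the maximum and the minimum of the same two row
lengths, so the sum telescopes. -/
theorem sum_interlace (π ρ : YoungDiagram) (N : ℕ) :
    ∑ i ∈ Finset.range N, (interlaceLower π ρ i + interlaceUpper π ρ i) +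
      interlaceUpper π ρ N = ∑ i ∈ Finset.range N, (π.rowLen i + ρ.rowLen i) + π.rowLen N := by
  induction N with
  | zero => simp [interlaceUpper]
  | succ N ih =>
    rw [Finset.sum_range_succ, Finset.sum_range_succ]
    simp only [interlaceLower, interlaceUpper] at ih ⊢
    omega

theorem card_add_card_bkReflect (π ρ σ : YoungDiagram)
    (h : ∀ i, interlaceLower π ρ i ≤ σ.rowLen i ∧ σ.rowLen i ≤ interlaceUpper π ρ i) :
    σ.card + (bkReflect π ρ σ h).card = π.card + ρ.card := by
  have h0 : π.rowLen (π.colLen 0) = 0 := rowLen_eq_zero_iff.2 le_rfl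
  have h1 := interlaceUpper_le π ρ (π.colLen 0)
  have h2 := h (π.colLen 0)
  have h3 := bkReflect_mem π ρ σ h (π.colLen 0)
  have h4 : ρ.rowLen (π.colLen 0) ≤ interlaceLower π ρ (π.colLen 0) := le_max_left _ _
  have h5 := sum_interlace π ρ (π.colLen 0)
  rw [card_eq_sum_rowLen (N := π.colLen 0) _ (by omega),
    card_eq_sum_rowLen (N := π.colLen 0) _ (by omega),
    card_eq_sum_rowLen (N := π.colLen 0) π (by omega),
    card_eq_sum_rowLen (N := π.colLen 0) ρ (by omega),
    ← Finset.sum_add_distrib, ← Finset.sum_add_distrib]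
  have h6 : ∀ i ∈ Finset.range (π.colLen 0), σ.rowLen i + (bkReflect π ρ σ h).rowLen i =
      interlaceLower π ρ i + interlaceUpper π ρ i := fun i _ => by
    have := h i
    rw [rowLen_bkReflect]
    omega
  rw [Finset.sum_congr rfl h6]
  omega

open Classical in
-- Reflecting every row in its interval sends σ to a diagram of size |π| + |ρ| - |σ|, which
-- exchanges the sizes of the two strips.
theorem card_hStrips_hStrips_comm (p q : ℕ) (π ρ : YoungDiagram) :
    ((hStrips q π).filter fun σ => ρ ∈ hStrips p σ).card =
      ((hStrips p π).filter fun σ => ρ ∈ hStrips q σ).card := by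
  -- The value σ outside the interlacing diagrams is a default that is never used.
  let f : YoungDiagram → YoungDiagram := fun σ =>
    if h : ∀ i, interlaceLower π ρ i ≤ σ.rowLen i ∧ σ.rowLen i ≤ interlaceUpper π ρ i then
      bkReflect π ρ σ h else σ
  have hmem : ∀ p q σ, σ ∈ (hStrips q π).filter (fun σ => ρ ∈ hStrips p σ) ↔
      (∀ i, interlaceLower π ρ i ≤ σ.rowLen i ∧ σ.rowLen i ≤ interlaceUpper π ρ i) ∧
        σ.card + q = π.card ∧ ρ.card + p = σ.card := fun p q σ => by
    rw [Finset.mem_filter, mem_hStrips_and_mem_hStrips]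
  have hmaps : ∀ p q σ, σ ∈ (hStrips q π).filter (fun σ => ρ ∈ hStrips p σ) →
      f σ ∈ (hStrips p π).filter (fun σ => ρ ∈ hStrips q σ) := fun p q σ hσ => by
    have h1 := (hmem p q σ).1 hσ
    have h2 := card_add_card_bkReflect π ρ σ h1.1
    rw [hmem, show f σ = bkReflect π ρ σ h1.1 from dif_pos h1.1]
    exact ⟨bkReflect_mem π ρ σ h1.1, by omega, by omega⟩
  have hinv : ∀ p q σ, σ ∈ (hStrips q π).filter (fun σ => ρ ∈ hStrips p σ) → f (f σ) = σ :=
      fun p q σ hσ => by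
    have h1 := ((hmem p q σ).1 hσ).1
    have h2 := bkReflect_mem π ρ σ h1
    rw [show f σ = bkReflect π ρ σ h1 from dif_pos h1,
      show f (bkReflect π ρ σ h1) = bkReflect π ρ _ h2 from dif_pos h2]
    refine ext_rowLen fun i => ?_
    rw [rowLen_bkReflect, rowLen_bkReflect]
    have := h1 i
    omega
  exact Finset.card_nbij' f f (hmaps p q) (hmaps q p) (hinv p q) (hinv q p)

/-- The last row in which `π` is longer than `ρ`. -/
noncomputable def lastRow (π ρ : YoungDiagram) : ℕ :=
  sSup {i | ρ.rowLen i < π.rowLen i}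

theorem lastRow_spec {π ρ : YoungDiagram} (h : ∃ i, ρ.rowLen i < π.rowLen i) :
    ρ.rowLen (lastRow π ρ) < π.rowLen (lastRow π ρ) ∧
      ∀ i, lastRow π ρ < i → π.rowLen i ≤ ρ.rowLen i := by
  have hb : BddAbove {i | ρ.rowLen i < π.rowLen i} := ⟨π.colLen 0, fun i hi => by
    have hi' : ρ.rowLen i < π.rowLen i := hi
    exact (rowLen_pos_iff.1 (by omega)).le⟩
  refine ⟨Nat.sSup_mem (s := {i | ρ.rowLen i < π.rowLen i}) h hb, fun i hi => ?_⟩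
  by_contra! hlt
  exact absurd (le_csSup hb (show i ∈ {i | ρ.rowLen i < π.rowLen i} from hlt)) (not_le.2 hi)

/-- Lengthen row `n` by one if it is as long as that of `ρ`, and shorten it by one otherwise. -/
theorem exists_toggle {π ρ σ : YoungDiagram} {n : ℕ}
    (hn : ρ.rowLen n < π.rowLen n) (hlast : ∀ i, n < i → π.rowLen i ≤ ρ.rowLen i)
    (h1 : ∀ i, π.rowLen (i + 1) ≤ σ.rowLen i ∧ σ.rowLen i ≤ π.rowLen i)
    (h2 : ∀ i, ρ.rowLen i ≤ σ.rowLen i ∧ σ.rowLen i ≤ ρ.rowLen i + 1) :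
    ∃ τ : YoungDiagram, ∀ i, τ.rowLen i =
      if i = n then 2 * ρ.rowLen n + 1 - σ.rowLen n else σ.rowLen i := by
  -- Row `n` of σ is as long as that of ρ or longer by one; `2 * ρ.rowLen n + 1 - σ.rowLen n`
  -- exchanges the two values.
  refine ⟨ofRowLenFun (fun i => if i = n then 2 * ρ.rowLen n + 1 - σ.rowLen n else σ.rowLen i)
    (antitone_nat_of_succ_le fun i => ?_) (π.colLen 0) ?_, fun i => rowLen_ofRowLenFun _ _ _ _ i⟩
  -- Row `n - 1` of σ is at least row `n` of π, which exceeds that of ρ; row `n + 1` of σ is at most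
  -- that of π, hence at most that of ρ by the choice of `n`. Both values in row `n` therefore give
  -- a diagram.
  · have e1 := h1 i
    have e2 := h1 (i + 1)
    have e3 := h2 n
    have e4 := hlast (n + 1) (by omega)
    have e5 := ρ.rowLen_anti n (n + 1) (by omega)
    have e6 := σ.rowLen_anti i (i + 1) (by omega)
    have e7 := h1 (n + 1)
    split_ifs with c1 c2 c3
    · omega
    · subst c1
      omega
    · subst c3
      omega
    · omega
  · have e0 : π.rowLen (π.colLen 0) = 0 := rowLen_eq_zero_iff.2 le_rfl
    have e1 := h1 (π.colLen 0)
    have e2 : n ≠ π.colLen 0 := by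
      rintro rfl
      omega
    rw [if_neg e2.symm]
    omega

theorem sum_toggle_card {σ τ : YoungDiagram} {n c : ℕ}
    (h : ∀ i, τ.rowLen i = if i = n then c else σ.rowLen i) :
    τ.card + σ.rowLen n = σ.card + c := by
  have hN1 : σ.rowLen (max (n + 1) (σ.colLen 0)) = 0 := rowLen_eq_zero_iff.2 (le_max_right _ _)
  have hN2 : τ.rowLen (max (n + 1) (σ.colLen 0)) = 0 := by
    rw [h, if_neg (by omega), hN1]
  have hmem : n ∈ Finset.range (max (n + 1) (σ.colLen 0)) := Finset.mem_range.2 (by omega)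
  have hsum : ∑ i ∈ (Finset.range (max (n + 1) (σ.colLen 0))).erase n, τ.rowLen i =
      ∑ i ∈ (Finset.range (max (n + 1) (σ.colLen 0))).erase n, σ.rowLen i :=
    Finset.sum_congr rfl fun i hi => by rw [h i, if_neg (Finset.ne_of_mem_erase hi)]
  rw [card_eq_sum_rowLen _ hN1, card_eq_sum_rowLen _ hN2, ← Finset.add_sum_erase _ _ hmem,
    ← Finset.add_sum_erase _ _ hmem, h n, if_pos rfl, hsum]
  omega

end YoungDiagram

/-! ### Strip operators and the relations between them. -/

open YoungDiagram

/-- The linear operator on formal combinations of diagrams that sends `π` to the sum of the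
diagrams in `s π`. -/
noncomputable def stripOp (K : Type*) [CommRing K] (s : YoungDiagram → Finset YoungDiagram) :
    (YoungDiagram →₀ K) →ₗ[K] (YoungDiagram →₀ K) :=
  Finsupp.linearCombination K fun π => ∑ σ ∈ s π, Finsupp.single σ 1

theorem stripOp_single {K : Type*} [CommRing K] (s : YoungDiagram → Finset YoungDiagram)
    (π : YoungDiagram) :
    stripOp K s (Finsupp.single π 1) = ∑ σ ∈ s π, Finsupp.single σ (1 : K) := by
  rw [stripOp, Finsupp.linearCombination_single, one_smul]

theorem stripOp_eq_id {K : Type*} [CommRing K] {s : YoungDiagram → Finset YoungDiagram}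
    (h : ∀ π, s π = {π}) : stripOp K s = LinearMap.id := by
  refine Finsupp.lhom_ext' fun π => LinearMap.ext_ring ?_
  simp [stripOp_single, h]

/-- Removal of horizontal strips of size `k`. -/
noncomputable abbrev hOp (K : Type*) [CommRing K] (k : ℕ) :
    (YoungDiagram →₀ K) →ₗ[K] (YoungDiagram →₀ K) :=
  stripOp K (hStrips k)

/-- Removal of vertical strips of size `k`. -/
noncomputable abbrev eOp (K : Type*) [CommRing K] (k : ℕ) :
    (YoungDiagram →₀ K) →ₗ[K] (YoungDiagram →₀ K) :=
  stripOp K (vStrips k)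

theorem hOp_zero (K : Type*) [CommRing K] : hOp K 0 = LinearMap.id :=
  stripOp_eq_id hStrips_zero

theorem eOp_zero (K : Type*) [CommRing K] : eOp K 0 = LinearMap.id :=
  stripOp_eq_id vStrips_zero

open Classical in
theorem stripOp_stripOp_single_apply {K : Type*} [CommRing K]
    (s t : YoungDiagram → Finset YoungDiagram) (π ρ : YoungDiagram) :
    stripOp K s (stripOp K t (Finsupp.single π 1)) ρ = ((t π).filter fun σ => ρ ∈ s σ).card := by
  rw [stripOp_single, map_sum, Finsupp.finsetSum_apply, Finset.card_filter, Nat.cast_sum]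
  refine Finset.sum_congr rfl fun σ _ => ?_
  rw [stripOp_single, Finsupp.finsetSum_apply]
  simp [Finsupp.single_apply]

theorem hOp_comm {K : Type*} [CommRing K] (p q : ℕ) (v : YoungDiagram →₀ K) :
    hOp K p (hOp K q v) = hOp K q (hOp K p v) := by
  suffices h : hOp K p ∘ₗ hOp K q = hOp K q ∘ₗ hOp K p from LinearMap.congr_fun h v
  refine Finsupp.lhom_ext' fun π => LinearMap.ext_ring (Finsupp.ext fun ρ => ?_)
  simp only [LinearMap.comp_apply, Finsupp.lsingle_apply]
  rw [stripOp_stripOp_single_apply, stripOp_stripOp_single_apply, card_hStrips_hStrips_comm]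

/-- Once the total size is fixed, σ determines both strip sizes, so a sum over pairs (i, j) and
diagrams σ becomes a sum over σ alone. -/
theorem mem_hStrips_and_mem_vStrips {i j k : ℕ} {π σ ρ : YoungDiagram} (hk : ρ.card + k = π.card)
    (hij : i + j = k) :
    σ ∈ hStrips j π ∧ ρ ∈ vStrips i σ ↔
      (σ ≤ π ∧ (∀ i, π.rowLen (i + 1) ≤ σ.rowLen i ∧ σ.rowLen i ≤ π.rowLen i) ∧
        (∀ i, ρ.rowLen i ≤ σ.rowLen i ∧ σ.rowLen i ≤ ρ.rowLen i + 1)) ∧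
          j = π.card - σ.card := by
  constructor
  · rintro ⟨h1, h2⟩
    have h3 := mem_hStrips.1 h1
    exact ⟨⟨le_of_mem_hStrips h1, h3.1, (mem_vStrips.1 h2).1⟩, by omega⟩
  · rintro ⟨⟨h1, h2, h3⟩, rfl⟩
    have h4 := card_le_card h1
    have h5 := card_le_card (le_iff_rowLen_le.2 fun i => (h3 i).1)
    exact ⟨mem_hStrips.2 ⟨h2, by omega⟩, mem_vStrips.2 ⟨h3, by omega⟩⟩

open Classical in
-- The toggle in the last row where π is longer than ρ is a sign-reversing involution without fixed
-- points on the intermediate diagrams.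
theorem sum_sign_eq_zero {K : Type*} [CommRing K] {π ρ : YoungDiagram}
    (h : ∃ i, ρ.rowLen i < π.rowLen i) :
    ∑ σ ∈ π.finite_setOf_le.toFinset.filter fun σ =>
      (∀ i, π.rowLen (i + 1) ≤ σ.rowLen i ∧ σ.rowLen i ≤ π.rowLen i) ∧
        (∀ i, ρ.rowLen i ≤ σ.rowLen i ∧ σ.rowLen i ≤ ρ.rowLen i + 1),
      (-1 : K) ^ (π.card - σ.card) = 0 := by
  obtain ⟨hn, hlast⟩ := lastRow_spec h
  generalize lastRow π ρ = n at hn hlast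
  have hs : ∀ {σ : YoungDiagram}, σ ∈ (π.finite_setOf_le.toFinset.filter fun σ =>
      (∀ i, π.rowLen (i + 1) ≤ σ.rowLen i ∧ σ.rowLen i ≤ π.rowLen i) ∧
        (∀ i, ρ.rowLen i ≤ σ.rowLen i ∧ σ.rowLen i ≤ ρ.rowLen i + 1)) ↔
      (∀ i, π.rowLen (i + 1) ≤ σ.rowLen i ∧ σ.rowLen i ≤ π.rowLen i) ∧
        (∀ i, ρ.rowLen i ≤ σ.rowLen i ∧ σ.rowLen i ≤ ρ.rowLen i + 1) := fun {σ} => by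
    rw [Finset.mem_filter, and_iff_right_iff_imp]
    intro h
    rw [Set.Finite.mem_toFinset]
    exact le_iff_rowLen_le.2 fun i => (h.1 i).2
  have ht := fun σ hσ => exists_toggle hn hlast (hs.1 hσ).1 (hs (σ := σ).1 hσ).2
  choose τ hτ using ht
  have hmem : ∀ σ hσ, (∀ i, π.rowLen (i + 1) ≤ (τ σ hσ).rowLen i ∧
      (τ σ hσ).rowLen i ≤ π.rowLen i) ∧
        (∀ i, ρ.rowLen i ≤ (τ σ hσ).rowLen i ∧ (τ σ hσ).rowLen i ≤ ρ.rowLen i + 1) := by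
    intro σ hσ
    have h1 := hs.1 hσ
    have e1 := h1.2 n
    have e4 := hlast (n + 1) (by omega)
    have e5 := ρ.rowLen_anti n (n + 1) (by omega)
    refine ⟨fun i => ?_, fun i => ?_⟩
    · rw [hτ]
      split_ifs with c
      · subst c
        omega
      · exact h1.1 i
    · rw [hτ]
      split_ifs with c
      · subst c
        omega
      · exact h1.2 i
  have hrow : ∀ σ hσ, (τ σ hσ).rowLen n = 2 * ρ.rowLen n + 1 - σ.rowLen n := fun σ hσ => by
    rw [hτ, if_pos rfl]
  refine Finset.sum_involution τ (fun σ hσ => ?_) (fun σ hσ _ heq => ?_)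
    (fun σ hσ => hs.2 (hmem σ hσ)) fun σ hσ => ext_rowLen fun i => ?_
  · have h1 := hs.1 hσ
    have h2 := sum_toggle_card (hτ σ hσ)
    have h3 := card_le_card (le_iff_rowLen_le.2 fun i => (h1.1 i).2)
    have h4 := card_le_card (le_iff_rowLen_le.2 fun i => ((hmem σ hσ).1 i).2)
    have h5 := h1.2 n
    -- The toggle changes the size by exactly one, so the two signs are opposite.
    have h6 : π.card - (τ σ hσ).card = π.card - σ.card + 1 ∨
        π.card - σ.card = π.card - (τ σ hσ).card + 1 := by omega
    rcases h6 with h6 | h6 <;> rw [h6, pow_succ] <;> ring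
  · have h1 := hrow σ hσ
    have h5 := (hs.1 hσ).2 n
    rw [heq] at h1
    omega
  · rw [hτ, hrow]
    split_ifs with c
    · have h5 := (hs.1 hσ).2 n
      subst c
      omega
    · rw [hτ, if_neg c]

/-- Adjoint form of the relation ∑ (-1)^j e_i h_j = 0: at each ρ of the right size the coefficient
is the signed count of intermediate diagrams in `sum_sign_eq_zero`. -/
theorem sum_eOp_hOp_single {K : Type*} [CommRing K] {k : ℕ} (hk : 0 < k) (π : YoungDiagram) :
    ∑ x ∈ Finset.HasAntidiagonal.antidiagonal k, (-1 : K) ^ x.2 • eOp K x.1 (hOp K x.2 (Finsupp.single π 1)) =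
      0 := by
  classical
  refine Finsupp.ext fun ρ => ?_
  rw [Finsupp.finsetSum_apply, Finsupp.zero_apply]
  simp only [Finsupp.smul_apply, smul_eq_mul, stripOp_stripOp_single_apply]
  by_cases hc : ρ.card + k = π.card
  · have hex : ∃ i, ρ.rowLen i < π.rowLen i := by
      by_contra! hle
      have := card_le_card (le_iff_rowLen_le.2 hle)
      omega
    rw [← sum_sign_eq_zero (K := K) hex]
    have h1 : ∀ x ∈ Finset.HasAntidiagonal.antidiagonal k,
        (-1 : K) ^ x.2 * (((hStrips x.2 π).filter fun σ => ρ ∈ vStrips x.1 σ).card : K) =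
        ∑ σ ∈ π.finite_setOf_le.toFinset.filter fun σ =>
          (∀ i, π.rowLen (i + 1) ≤ σ.rowLen i ∧ σ.rowLen i ≤ π.rowLen i) ∧
            (∀ i, ρ.rowLen i ≤ σ.rowLen i ∧ σ.rowLen i ≤ ρ.rowLen i + 1),
          if x.2 = π.card - σ.card then (-1 : K) ^ (π.card - σ.card) else 0 := fun x hx => by
      rw [← Finset.sum_filter, Finset.sum_congr rfl (g := fun _ => (-1 : K) ^ x.2)
        fun σ hσ => by rw [(Finset.mem_filter.1 hσ).2], Finset.sum_const, nsmul_eq_mul, mul_comm]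
      congr 3
      ext σ
      rw [Finset.mem_filter, mem_hStrips_and_mem_vStrips hc (Finset.HasAntidiagonal.mem_antidiagonal.1 hx)]
      simp
    rw [Finset.sum_congr rfl h1, Finset.sum_comm]
    refine Finset.sum_congr rfl fun σ hσ => ?_
    obtain ⟨-, -, h2⟩ := Finset.mem_filter.1 hσ
    have h3 := card_le_card (le_iff_rowLen_le.2 fun i => (h2 i).1)
    rw [Finset.sum_eq_single (k - (π.card - σ.card), π.card - σ.card), if_pos rfl]
    · rintro ⟨i, j⟩ hx hne
      rw [Finset.HasAntidiagonal.mem_antidiagonal] at hx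
      rw [if_neg]
      rintro h
      dsimp only at h hx
      exact hne (Prod.ext (by dsimp only; omega) h)
    · intro h
      rw [Finset.HasAntidiagonal.mem_antidiagonal] at h
      dsimp only at h
      omega
  · refine Finset.sum_eq_zero fun x hx => ?_
    rw [Finset.filter_eq_empty_iff.2, Finset.card_empty, Nat.cast_zero, mul_zero]
    intro σ h1 h2
    have h3 := (mem_hStrips.1 h1).2
    have h4 := (mem_vStrips.1 h2).2
    rw [Finset.HasAntidiagonal.mem_antidiagonal] at hx
    omega

theorem sum_eOp_hOp {K : Type*} [CommRing K] {k : ℕ} (hk : 0 < k) (v : YoungDiagram →₀ K) :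
    ∑ x ∈ Finset.HasAntidiagonal.antidiagonal k, (-1 : K) ^ x.2 • eOp K x.1 (hOp K x.2 v) = 0 := by
  suffices h : ∑ x ∈ Finset.HasAntidiagonal.antidiagonal k, (-1 : K) ^ x.2 • (eOp K x.1 ∘ₗ hOp K x.2) = 0 by
    simpa using LinearMap.congr_fun h v
  refine Finsupp.lhom_ext' fun π => LinearMap.ext_ring ?_
  simpa using sum_eOp_hOp_single hk π

/-! ### Splitting off the first variable of a power series. -/

/-- The exponent vector `(k, m 0, m 1, …)`. -/
noncomputable def consExp (k : ℕ) (m : ℕ →₀ ℕ) : ℕ →₀ ℕ :=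
  Finsupp.single 0 k + m.mapDomain Nat.succ

@[simp]
theorem consExp_zero (k : ℕ) (m : ℕ →₀ ℕ) : consExp k m 0 = k := by
  rw [consExp, Finsupp.add_apply, Finsupp.single_eq_same,
    Finsupp.mapDomain_of_notMem_range _ _ (by simp), add_zero]

@[simp]
theorem consExp_succ (k : ℕ) (m : ℕ →₀ ℕ) (i : ℕ) : consExp k m (i + 1) = m i := by
  rw [consExp, Finsupp.add_apply, Finsupp.single_eq_of_ne (by omega), zero_add]
  exact Finsupp.mapDomain_apply Nat.succ_injective m i

/-- The exponent vector `(m 1, m 2, …)`. -/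
noncomputable def tailExp (m : ℕ →₀ ℕ) : ℕ →₀ ℕ :=
  m.comapDomain Nat.succ Nat.succ_injective.injOn

@[simp]
theorem tailExp_apply (m : ℕ →₀ ℕ) (i : ℕ) : tailExp m i = m (i + 1) :=
  rfl

@[simp]
theorem tailExp_consExp (k : ℕ) (m : ℕ →₀ ℕ) : tailExp (consExp k m) = m :=
  Finsupp.ext fun i => by simp

@[simp]
theorem consExp_tailExp (m : ℕ →₀ ℕ) : consExp (m 0) (tailExp m) = m :=
  Finsupp.ext fun i => by cases i <;> simp

theorem consExp_add (i j : ℕ) (m n : ℕ →₀ ℕ) :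
    consExp (i + j) (m + n) = consExp i m + consExp j n :=
  Finsupp.ext fun i => by cases i <;> simp

theorem degree_consExp (k : ℕ) (m : ℕ →₀ ℕ) : (consExp k m).degree = k + m.degree := by
  rw [consExp, map_add, Finsupp.degree_single, Finsupp.degree_mapDomain]

/-- The coefficient of `x₀ ^ k`, as a power series in `x₁, x₂, …` renamed to `x₀, x₁, …`. -/
noncomputable def headCoeff (K : Type*) [CommRing K] (k : ℕ) : MvPowerSeries ℕ K →ₗ[K] MvPowerSeries ℕ K where
  toFun F := fun m => MvPowerSeries.coeff (consExp k m) F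
  map_add' F G := funext fun _ => map_add _ F G
  map_smul' c F := funext fun m => map_smul (MvPowerSeries.coeff (consExp k m)) c F

theorem coeff_headCoeff {K : Type*} [CommRing K] (k : ℕ) (m : ℕ →₀ ℕ) (F : MvPowerSeries ℕ K) :
    MvPowerSeries.coeff m (headCoeff K k F) = MvPowerSeries.coeff (consExp k m) F :=
  rfl

theorem headCoeff_mul {K : Type*} [CommRing K] (k : ℕ) (F G : MvPowerSeries ℕ K) :
    headCoeff K k (F * G) =
      ∑ x ∈ Finset.HasAntidiagonal.antidiagonal k, headCoeff K x.1 F * headCoeff K x.2 G := by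
  classical
  refine MvPowerSeries.ext fun m => ?_
  rw [coeff_headCoeff, MvPowerSeries.coeff_mul, map_sum]
  simp only [MvPowerSeries.coeff_mul, coeff_headCoeff]
  rw [← Finset.sum_product']
  refine Finset.sum_nbij' (fun p => ((p.1 0, p.2 0), (tailExp p.1, tailExp p.2)))
    (fun q => (consExp q.1.1 q.2.1, consExp q.1.2 q.2.2)) ?_ ?_ ?_ ?_ ?_
  · rintro ⟨u, v⟩ h
    rw [Finset.HasAntidiagonal.mem_antidiagonal] at h
    dsimp only at h
    rw [Finset.mem_product, Finset.HasAntidiagonal.mem_antidiagonal,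
      Finset.HasAntidiagonal.mem_antidiagonal]
    refine ⟨?_, Finsupp.ext fun i => ?_⟩
    · simpa using DFunLike.congr_fun h 0
    · simpa using DFunLike.congr_fun h (i + 1)
  · rintro ⟨⟨i, j⟩, u, v⟩ h
    rw [Finset.mem_product, Finset.HasAntidiagonal.mem_antidiagonal,
      Finset.HasAntidiagonal.mem_antidiagonal] at h
    dsimp only at h
    rw [Finset.HasAntidiagonal.mem_antidiagonal, ← consExp_add, h.1, h.2]
  · rintro ⟨u, v⟩ _
    simp
  · rintro ⟨⟨i, j⟩, u, v⟩ _
    simp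
  · rintro ⟨u, v⟩ _
    simp

/-! ### Coefficients of Schur functions through strip operators. -/

/-- The linear map that sends a diagram to its Schur function. -/
noncomputable def schurMap (K : Type*) [CommRing K] :
    (YoungDiagram →₀ K) →ₗ[K] MvPowerSeries ℕ K :=
  Finsupp.linearCombination K (schur K)

theorem schurMap_apply {K : Type*} [CommRing K] (c : YoungDiagram →₀ K) :
    schurMap K c = c.sum fun ν k => k • schur K ν :=
  rfl

@[simp]
theorem schurMap_single {K : Type*} [CommRing K] (π : YoungDiagram) :
    schurMap K (Finsupp.single π 1) = schur K π := by
  rw [schurMap, Finsupp.linearCombination_single, one_smul]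

theorem coeff_schur {K : Type*} [CommRing K] (m : ℕ →₀ ℕ) (π : YoungDiagram) :
    MvPowerSeries.coeff m (schur K π) =
      (Nat.card {T : SemistandardYoungTableau π // tableauWeight T = m} : K) :=
  rfl

theorem coeff_schurMap_erase {K : Type*} [CommRing K] {m : ℕ →₀ ℕ} {n : ℕ}
    (hm : ∀ k, n + 1 ≤ k → m k = 0) (v : YoungDiagram →₀ K) :
    MvPowerSeries.coeff m (schurMap K v) =
      MvPowerSeries.coeff (m.erase n) (schurMap K (hOp K (m n) v)) := by
  suffices h : MvPowerSeries.coeff m ∘ₗ schurMap K =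
      MvPowerSeries.coeff (m.erase n) ∘ₗ schurMap K ∘ₗ hOp K (m n) from LinearMap.congr_fun h v
  refine Finsupp.lhom_ext' fun π => LinearMap.ext_ring ?_
  simp only [LinearMap.comp_apply, Finsupp.lsingle_apply, stripOp_single, map_sum,
    schurMap_single, coeff_schur]
  rw [SemistandardYoungTableau.card_tableaux_eq_sum π hm, Nat.cast_sum]

theorem coeff_zero_schurMap {K : Type*} [CommRing K] (v : YoungDiagram →₀ K) :
    MvPowerSeries.coeff 0 (schurMap K v) = v ⊥ := by
  classical
  suffices h : MvPowerSeries.coeff 0 ∘ₗ schurMap K = Finsupp.lapply ⊥ from LinearMap.congr_fun h v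
  refine Finsupp.lhom_ext' fun π => LinearMap.ext_ring ?_
  simp only [LinearMap.comp_apply, Finsupp.lsingle_apply, schurMap_single, coeff_schur,
    Finsupp.lapply_apply]
  rw [SemistandardYoungTableau.card_tableaux_zero, Finsupp.single_apply]
  simp

/-- The composition of the operators that remove horizontal strips of sizes
`m (n - 1), …, m 1, m 0`, in this order. -/
noncomputable def hOpProd (K : Type*) [CommRing K] (m : ℕ → ℕ) :
    ℕ → (YoungDiagram →₀ K) →ₗ[K] (YoungDiagram →₀ K)
  | 0 => LinearMap.id
  | n + 1 => hOpProd K m n ∘ₗ hOp K (m n)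

theorem hOpProd_succ {K : Type*} [CommRing K] (m : ℕ → ℕ) (n : ℕ) (v : YoungDiagram →₀ K) :
    hOpProd K m (n + 1) v = hOpProd K m n (hOp K (m n) v) :=
  rfl

theorem hOpProd_congr {K : Type*} [CommRing K] {m m' : ℕ → ℕ} {n : ℕ} (h : ∀ k < n, m k = m' k) :
    hOpProd K m n = hOpProd K m' n := by
  induction n with
  | zero => rfl
  | succ n ih =>
    rw [hOpProd, hOpProd, ih fun k hk => h k (by omega), h n (by omega)]

/-- Branching on tableaux removes the last variable first. Since the operators commute, the strip
for variable `0` can be removed first instead. -/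
theorem hOpProd_succ' {K : Type*} [CommRing K] (m : ℕ → ℕ) (n : ℕ) (v : YoungDiagram →₀ K) :
    hOpProd K m (n + 1) v = hOpProd K (fun i => m (i + 1)) n (hOp K (m 0) v) := by
  induction n generalizing v with
  | zero => rfl
  | succ n ih => rw [hOpProd_succ, ih, hOp_comm, ← hOpProd_succ (fun i => m (i + 1))]

theorem coeff_schurMap {K : Type*} [CommRing K] {m : ℕ →₀ ℕ} {n : ℕ}
    (hm : ∀ k, n ≤ k → m k = 0) (v : YoungDiagram →₀ K) :
    MvPowerSeries.coeff m (schurMap K v) = hOpProd K m n v ⊥ := by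
  induction n generalizing m v with
  | zero =>
    obtain rfl : m = 0 := Finsupp.ext fun k => hm k (Nat.zero_le k)
    exact coeff_zero_schurMap v
  | succ n ih =>
    rw [coeff_schurMap_erase hm, ih fun k hk => ?_, hOpProd_succ, hOpProd_congr fun k hk => ?_]
    · rw [Finsupp.erase_ne (by omega)]
    · rcases eq_or_ne k n with rfl | hne
      · simp
      · rw [Finsupp.erase_ne hne]
        exact hm k (by omega)

/-- The branching rule for the first variable. -/
theorem headCoeff_schurMap {K : Type*} [CommRing K] (k : ℕ) (v : YoungDiagram →₀ K) :
    headCoeff K k (schurMap K v) = schurMap K (hOp K k v) := by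
  refine MvPowerSeries.ext fun m => ?_
  obtain ⟨n, hn⟩ : ∃ n, ∀ i, n ≤ i → m i = 0 := by
    refine ⟨m.support.sup id + 1, fun i hi => ?_⟩
    by_contra h
    have := Finset.le_sup (f := id) (Finsupp.mem_support_iff.2 h)
    simp only [id] at this
    omega
  rw [coeff_headCoeff, coeff_schurMap (n := n + 1) fun i hi => ?_, coeff_schurMap hn,
    hOpProd_succ']
  · simp
  · obtain ⟨i, rfl⟩ := Nat.exists_eq_succ_of_ne_zero (show i ≠ 0 by omega)
    rw [Nat.succ_eq_add_one, consExp_succ]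
    exact hn i (by omega)

/-! ### The operators that remove vertical strips, and their product rule. -/

/-- Both sides run over all quadruples with sum `n`; the bijection transposes the quadruple seen as
a 2 × 2 array. -/
theorem sum_antidiagonal_interchange {M : Type*} [AddCommMonoid M] (f : ℕ → ℕ → ℕ → ℕ → M)
    (n : ℕ) :
    ∑ x ∈ Finset.HasAntidiagonal.antidiagonal n, ∑ y ∈ Finset.HasAntidiagonal.antidiagonal x.1,
      ∑ z ∈ Finset.HasAntidiagonal.antidiagonal x.2, f y.1 y.2 z.1 z.2 =
    ∑ x ∈ Finset.HasAntidiagonal.antidiagonal n, ∑ y ∈ Finset.HasAntidiagonal.antidiagonal x.1,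
      ∑ z ∈ Finset.HasAntidiagonal.antidiagonal x.2, f y.1 z.1 y.2 z.2 := by
  simp only [← Finset.sum_product', Finset.sum_sigma']
  refine Finset.sum_nbij'
    (fun s => ⟨(s.2.1.1 + s.2.2.1, s.2.1.2 + s.2.2.2), ((s.2.1.1, s.2.2.1), (s.2.1.2, s.2.2.2))⟩)
    (fun s => ⟨(s.2.1.1 + s.2.2.1, s.2.1.2 + s.2.2.2), ((s.2.1.1, s.2.2.1), (s.2.1.2, s.2.2.2))⟩)
    ?_ ?_ ?_ ?_ ?_
  · rintro ⟨⟨i, j⟩, ⟨a, b⟩, ⟨c, d⟩⟩ h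
    simp only [Finset.mem_sigma, Finset.mem_product,
      Finset.HasAntidiagonal.mem_antidiagonal, and_true] at h ⊢
    omega
  · rintro ⟨⟨i, j⟩, ⟨a, b⟩, ⟨c, d⟩⟩ h
    simp only [Finset.mem_sigma, Finset.mem_product,
      Finset.HasAntidiagonal.mem_antidiagonal, and_true] at h ⊢
    omega
  · rintro ⟨⟨i, j⟩, ⟨a, b⟩, ⟨c, d⟩⟩ h
    simp only [Finset.mem_sigma, Finset.mem_product,
      Finset.HasAntidiagonal.mem_antidiagonal] at h
    obtain ⟨-, rfl, rfl⟩ := h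
    rfl
  · rintro ⟨⟨i, j⟩, ⟨a, b⟩, ⟨c, d⟩⟩ h
    simp only [Finset.mem_sigma, Finset.mem_product,
      Finset.HasAntidiagonal.mem_antidiagonal] at h
    obtain ⟨-, rfl, rfl⟩ := h
    rfl
  · rintro ⟨⟨i, j⟩, ⟨a, b⟩, ⟨c, d⟩⟩ _
    rfl

/-- The operators determined by the recursion dual to that of elementary and complete
symmetric functions; on Schur functions they remove vertical strips. -/
noncomputable def dualCoeff (K : Type*) [CommRing K] :
    ℕ → MvPowerSeries ℕ K →ₗ[K] MvPowerSeries ℕ K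
  | 0 => LinearMap.id
  | k + 1 => ∑ x ∈ (Finset.HasAntidiagonal.antidiagonal k).attach,
      (-1 : K) ^ x.1.2 • (dualCoeff K x.1.1 ∘ₗ headCoeff K (x.1.2 + 1))
  decreasing_by
    have := Finset.HasAntidiagonal.mem_antidiagonal.1 x.2
    omega

theorem dualCoeff_zero (K : Type*) [CommRing K] (F : MvPowerSeries ℕ K) :
    dualCoeff K 0 F = F := by
  rw [dualCoeff]
  rfl

theorem dualCoeff_succ {K : Type*} [CommRing K] (k : ℕ) (F : MvPowerSeries ℕ K) :
    dualCoeff K (k + 1) F = ∑ x ∈ Finset.HasAntidiagonal.antidiagonal k,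
      (-1 : K) ^ x.2 • dualCoeff K x.1 (headCoeff K (x.2 + 1) F) := by
  rw [dualCoeff, Finset.sum_attach (Finset.HasAntidiagonal.antidiagonal k) fun x =>
    (-1 : K) ^ x.2 • (dualCoeff K x.1 ∘ₗ headCoeff K (x.2 + 1))]
  simp [LinearMap.sum_apply]

/-- The alternating relation solved for its term without an h-operator. This is the recursion that
defines `dualCoeff`. -/
theorem eOp_succ {K : Type*} [CommRing K] (k : ℕ) (v : YoungDiagram →₀ K) :
    eOp K (k + 1) v = ∑ x ∈ Finset.HasAntidiagonal.antidiagonal k,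
      (-1 : K) ^ x.2 • eOp K x.1 (hOp K (x.2 + 1) v) := by
  have h := sum_eOp_hOp (Nat.succ_pos k) v
  rw [Finset.Nat.sum_antidiagonal_succ'] at h
  simp only [pow_succ, pow_zero, one_smul, mul_neg, mul_one, neg_smul, Finset.sum_neg_distrib,
    hOp_zero, LinearMap.id_apply] at h
  rwa [add_neg_eq_zero] at h

theorem dualCoeff_schurMap {K : Type*} [CommRing K] (k : ℕ) (v : YoungDiagram →₀ K) :
    dualCoeff K k (schurMap K v) = schurMap K (eOp K k v) := by
  induction k using Nat.strong_induction_on generalizing v with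
  | _ k ih =>
    cases k with
    | zero => rw [dualCoeff_zero, eOp_zero, LinearMap.id_apply]
    | succ k =>
      rw [dualCoeff_succ, eOp_succ, map_sum]
      refine Finset.sum_congr rfl fun x hx => ?_
      have := Finset.HasAntidiagonal.mem_antidiagonal.1 hx
      rw [headCoeff_schurMap, ih x.1 (by omega), map_smul]

theorem sum_schurMap_eOp_hOp {K : Type*} [CommRing K] (n : ℕ) (v : YoungDiagram →₀ K) :
    ∑ x ∈ Finset.HasAntidiagonal.antidiagonal n,
      (-1 : K) ^ x.2 • schurMap K (eOp K x.1 (hOp K x.2 v)) = if n = 0 then schurMap K v else 0 := by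
  split_ifs with h
  · subst h
    simp [eOp_zero, hOp_zero]
  · have h1 := congrArg (schurMap K) (sum_eOp_hOp (Nat.pos_of_ne_zero h) v)
    simpa only [map_sum, map_smul, map_zero] using h1

/-- After the interchange, the sum splits into products of an alternating sum for `v` and one for
`w`. Each vanishes in positive size, and two sizes with sum `n > 0` are not both zero. -/
theorem sum_eOp_hOp_mul {K : Type*} [CommRing K] {n : ℕ} (hn : 0 < n)
    (v w : YoungDiagram →₀ K) :
    ∑ x ∈ Finset.HasAntidiagonal.antidiagonal n, (-1 : K) ^ x.2 •
      ∑ y ∈ Finset.HasAntidiagonal.antidiagonal x.1,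
        ∑ z ∈ Finset.HasAntidiagonal.antidiagonal x.2,
          schurMap K (eOp K y.1 (hOp K z.1 v)) * schurMap K (eOp K y.2 (hOp K z.2 w)) = 0 := by
  have h := sum_antidiagonal_interchange (fun a b c d =>
    ((-1 : K) ^ c • schurMap K (eOp K a (hOp K c v))) *
      ((-1 : K) ^ d • schurMap K (eOp K b (hOp K d w)))) n
  simp only [← Finset.sum_mul_sum, sum_schurMap_eOp_hOp] at h
  rw [Finset.sum_eq_zero (s := Finset.HasAntidiagonal.antidiagonal n) (f := fun x =>
    (if x.1 = 0 then schurMap K v else 0) * (if x.2 = 0 then schurMap K w else 0))] at h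
  · rw [← h]
    refine Finset.sum_congr rfl fun x _ => ?_
    rw [Finset.smul_sum]
    refine Finset.sum_congr rfl fun y _ => ?_
    rw [Finset.smul_sum]
    refine Finset.sum_congr rfl fun z hz => ?_
    rw [smul_mul_smul_comm, ← pow_add, Finset.HasAntidiagonal.mem_antidiagonal.1 hz]
  · intro x hx
    have := Finset.HasAntidiagonal.mem_antidiagonal.1 hx
    by_cases h1 : x.1 = 0
    · rw [if_neg (show x.2 ≠ 0 by omega), mul_zero]
    · rw [if_neg h1, zero_mul]

theorem dualCoeff_mul {K : Type*} [CommRing K] (k : ℕ) (v w : YoungDiagram →₀ K) :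
    dualCoeff K k (schurMap K v * schurMap K w) =
      ∑ x ∈ Finset.HasAntidiagonal.antidiagonal k,
        schurMap K (eOp K x.1 v) * schurMap K (eOp K x.2 w) := by
  induction k using Nat.strong_induction_on generalizing v w with
  | _ k ih =>
    cases k with
    | zero => simp [dualCoeff_zero, eOp_zero]
    | succ k =>
      have h := sum_eOp_hOp_mul (Nat.succ_pos k) v w
      -- The term with `x.2 = 0` is the wanted right-hand side; the others reproduce the recursion
      -- for `dualCoeff` by induction.
      rw [Finset.Nat.sum_antidiagonal_succ'] at h
      simp only [pow_succ, pow_zero, one_smul, mul_neg, mul_one, neg_smul, Finset.sum_neg_distrib,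
        hOp_zero, LinearMap.id_apply, Finset.Nat.antidiagonal_zero, Finset.sum_singleton] at h
      rw [add_neg_eq_zero] at h
      rw [h, dualCoeff_succ]
      refine Finset.sum_congr rfl fun x hx => ?_
      have := Finset.HasAntidiagonal.mem_antidiagonal.1 hx
      rw [headCoeff_mul, map_sum, Finset.sum_comm]
      simp only [headCoeff_schurMap]
      congr 1
      exact Finset.sum_congr rfl fun y _ => ih x.1 (by omega) _ _

/-! ### Peeling the top part, and linear independence of Schur functions. -/

theorem exists_of_mem_support_stripOp {K : Type*} [CommRing K]
    {s : YoungDiagram → Finset YoungDiagram} {v : YoungDiagram →₀ K} {σ : YoungDiagram}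
    (h : σ ∈ (stripOp K s v).support) : ∃ π ∈ v.support, σ ∈ s π := by
  classical
  by_contra! hc
  refine Finsupp.mem_support_iff.1 h ?_
  rw [stripOp, Finsupp.linearCombination_apply, Finsupp.sum, Finsupp.finsetSum_apply]
  refine Finset.sum_eq_zero fun π hπ => ?_
  rw [Finsupp.smul_apply, Finsupp.finsetSum_apply, Finset.sum_eq_zero, smul_zero]
  intro τ hτ
  rw [Finsupp.single_apply, if_neg]
  rintro rfl
  exact hc π hπ hτ

/-- If `s` removes the part of size `t` from diagrams for which the size of this part is at most
`t`, then `stripOp K s` transports the coefficients of diagrams for which this size is `t`. -/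
theorem stripOp_apply_of_top {K : Type*} [CommRing K] {s : YoungDiagram → Finset YoungDiagram}
    {top : YoungDiagram → ℕ} {strip : YoungDiagram → YoungDiagram} {t : ℕ}
    (hlt : ∀ π, top π < t → s π = ∅) (heq : ∀ π, top π = t → s π = {strip π})
    (hinj : ∀ π σ, top π = top σ → strip π = strip σ → π = σ)
    {v : YoungDiagram →₀ K} (hv : ∀ π ∈ v.support, top π ≤ t) {π : YoungDiagram}
    (hπ : top π = t) : stripOp K s v (strip π) = v π := by
  classical
  rw [stripOp, Finsupp.linearCombination_apply, Finsupp.sum, Finsupp.finsetSum_apply,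
    Finset.sum_eq_single π]
  · simp [heq π hπ]
  · intro σ hσ hne
    rcases (hv σ hσ).lt_or_eq with h | h
    · simp [hlt σ h]
    · rw [heq σ h, Finset.sum_singleton, Finsupp.smul_apply, Finsupp.single_apply, if_neg,
        smul_zero]
      exact fun h' => hne (hinj σ π (h.trans hπ.symm) h')
  · intro h
    simp [Finsupp.notMem_support_iff.1 h]

theorem exists_top_of_ne_zero {K : Type*} [CommRing K] (top : YoungDiagram → ℕ)
    {v : YoungDiagram →₀ K} (hv : v ≠ 0) :
    ∃ π ∈ v.support, ∀ σ ∈ v.support, top σ ≤ top π :=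
  Finset.exists_max_image v.support top (Finsupp.support_nonempty_iff.2 hv)

theorem hOp_apply_tailRows {K : Type*} [CommRing K] {t : ℕ} {v : YoungDiagram →₀ K}
    (hv : ∀ π ∈ v.support, π.rowLen 0 ≤ t) {π : YoungDiagram} (hπ : π.rowLen 0 = t) :
    hOp K t v π.tailRows = v π :=
  stripOp_apply_of_top (top := fun π => π.rowLen 0) (fun _ h => hStrips_eq_empty h)
    (fun π h => by rw [← h, hStrips_rowLen_zero]) (fun _ _ => eq_of_tailRows_eq) hv hπ

theorem eOp_apply_tailCols {K : Type*} [CommRing K] {t : ℕ} {v : YoungDiagram →₀ K}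
    (hv : ∀ π ∈ v.support, π.colLen 0 ≤ t) {π : YoungDiagram} (hπ : π.colLen 0 = t) :
    eOp K t v π.tailCols = v π :=
  stripOp_apply_of_top (top := fun π => π.colLen 0) (fun _ h => vStrips_eq_empty h)
    (fun π h => by rw [← h, vStrips_colLen_zero]) (fun _ _ => eq_of_tailCols_eq) hv hπ

/-- In a nonzero combination, take a diagram with longest first row. The strip operator of that size
keeps its coefficient and lowers the degree, so induction applies; if all rows are empty, the
constant coefficient decides. -/
theorem schurMap_eq_zero {K : Type*} [CommRing K] {v : YoungDiagram →₀ K}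
    (h : schurMap K v = 0) : v = 0 := by
  obtain ⟨d, hd⟩ : ∃ d, ∀ π ∈ v.support, π.card ≤ d :=
    ⟨v.support.sup YoungDiagram.card, fun π hπ => Finset.le_sup (f := YoungDiagram.card) hπ⟩
  induction d using Nat.strong_induction_on generalizing v with
  | _ d ih =>
    by_contra hne
    obtain ⟨π, hπ, hmax⟩ := exists_top_of_ne_zero (fun σ => σ.rowLen 0) hne
    have hπ' := Finsupp.mem_support_iff.1 hπ
    rcases Nat.eq_zero_or_pos (π.rowLen 0) with h0 | h0
    · obtain rfl : π = ⊥ := ext_rowLen fun i => by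
        have := π.rowLen_anti 0 i (Nat.zero_le i)
        rw [rowLen_bot]
        omega
      rw [← coeff_zero_schurMap, h, map_zero] at hπ'
      exact hπ' rfl
    · have h1 : schurMap K (hOp K (π.rowLen 0) v) = 0 := by
        rw [← headCoeff_schurMap, h, map_zero]
      have h2 := hd π hπ
      have h3 := π.card_tailRows
      refine hπ' ?_
      rw [← hOp_apply_tailRows hmax rfl, ih (d - π.rowLen 0) (by omega) h1, Finsupp.zero_apply]
      intro σ hσ
      obtain ⟨τ, hτ, hστ⟩ := exists_of_mem_support_stripOp hσ
      have h4 := (mem_hStrips.1 hστ).2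
      have h5 := hd τ hτ
      omega

theorem schurMap_injective (K : Type*) [CommRing K] : Function.Injective (schurMap K) :=
  (injective_iff_map_eq_zero _).2 fun _ => schurMap_eq_zero

/-! ### Products of Schur functions are combinations of Schur functions. -/

theorem degree_tableauWeight {μ : YoungDiagram} (T : SemistandardYoungTableau μ) :
    (tableauWeight T).degree = μ.card := by
  rw [tableauWeight, map_sum]
  simp

theorem coeff_schur_of_degree_ne {K : Type*} [CommRing K] {π : YoungDiagram} {m : ℕ →₀ ℕ}
    (h : m.degree ≠ π.card) : MvPowerSeries.coeff m (schur K π) = 0 := by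
  rw [coeff_schur, Nat.card_eq_zero.2, Nat.cast_zero]
  refine Or.inl ⟨fun T => h ?_⟩
  rw [← T.2, degree_tableauWeight]

theorem coeff_schurMap_of_lt_degree {K : Type*} [CommRing K] {v : YoungDiagram →₀ K} {d : ℕ}
    (hv : ∀ π ∈ v.support, π.card ≤ d) {m : ℕ →₀ ℕ} (hm : d < m.degree) :
    MvPowerSeries.coeff m (schurMap K v) = 0 := by
  rw [schurMap_apply, Finsupp.sum, map_sum]
  refine Finset.sum_eq_zero fun π hπ => ?_
  have := hv π hπ
  rw [map_smul, coeff_schur_of_degree_ne (by omega), smul_zero]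

theorem schur_bot (K : Type*) [CommRing K] : schur K ⊥ = 1 := by
  classical
  refine MvPowerSeries.ext fun m => ?_
  rw [MvPowerSeries.coeff_one]
  split_ifs with h
  · subst h
    rw [coeff_schur, SemistandardYoungTableau.card_tableaux_zero, if_pos rfl, Nat.cast_one]
  · exact coeff_schur_of_degree_ne (by simpa [YoungDiagram.card, Finsupp.degree_eq_zero_iff] using h)

theorem hOp_eq_zero {K : Type*} [CommRing K] {v : YoungDiagram →₀ K} {t : ℕ}
    (hv : ∀ π ∈ v.support, π.rowLen 0 < t) : hOp K t v = 0 := by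
  by_contra h
  obtain ⟨σ, hσ⟩ := Finsupp.support_nonempty_iff.2 h
  obtain ⟨π, hπ, hσπ⟩ := exists_of_mem_support_stripOp hσ
  rw [hStrips_eq_empty (hv π hπ)] at hσπ
  exact Finset.notMem_empty _ hσπ

/-- The diagrams of a combination annihilated by the removal of long horizontal strips have
short rows. -/
theorem rowLen_le_of_hOp_eq_zero {K : Type*} [CommRing K] {v : YoungDiagram →₀ K} {p : ℕ}
    (h : ∀ q, p < q → hOp K q v = 0) : ∀ π ∈ v.support, π.rowLen 0 ≤ p := by
  intro π hπ
  obtain ⟨σ, hσ, hmax⟩ := exists_top_of_ne_zero (fun σ => σ.rowLen 0)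
    (Finsupp.support_nonempty_iff.1 ⟨π, hπ⟩)
  refine (hmax π hπ).trans ?_
  by_contra! hlt
  refine Finsupp.mem_support_iff.1 hσ ?_
  rw [← hOp_apply_tailRows hmax rfl, h _ hlt, Finsupp.zero_apply]

theorem colLen_le_of_eOp_eq_zero {K : Type*} [CommRing K] {v : YoungDiagram →₀ K} {p : ℕ}
    (h : ∀ q, p < q → eOp K q v = 0) : ∀ π ∈ v.support, π.colLen 0 ≤ p := by
  intro π hπ
  obtain ⟨σ, hσ, hmax⟩ := exists_top_of_ne_zero (fun σ => σ.colLen 0)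
    (Finsupp.support_nonempty_iff.1 ⟨π, hπ⟩)
  refine (hmax π hπ).trans ?_
  by_contra! hlt
  refine Finsupp.mem_support_iff.1 hσ ?_
  rw [← eOp_apply_tailCols hmax rfl, h _ hlt, Finsupp.zero_apply]

/-- No monomial of `G` contains x₀, and by `h0` dropping x₀ and renaming the other variables gives
`G` back. Repeating this removes every variable and leaves only the constant coefficient. -/
theorem eq_zero_of_headCoeff {K : Type*} [CommRing K] {G : MvPowerSeries ℕ K}
    (h0 : headCoeff K 0 G = G) (hpos : ∀ q, 0 < q → headCoeff K q G = 0)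
    (hc : MvPowerSeries.coeff 0 G = 0) : G = 0 := by
  suffices h : ∀ (n : ℕ) (m : ℕ →₀ ℕ), (∀ k, n ≤ k → m k = 0) → MvPowerSeries.coeff m G = 0 by
    refine MvPowerSeries.ext fun m => ?_
    refine h (m.support.sup id + 1) m fun i hi => ?_
    by_contra hne
    have := Finset.le_sup (f := id) (Finsupp.mem_support_iff.2 hne)
    simp only [id] at this
    omega
  intro n
  induction n with
  | zero =>
    intro m hm
    obtain rfl : m = 0 := Finsupp.ext fun k => hm k (Nat.zero_le k)
    exact hc
  | succ n ih =>
    intro m hm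
    rw [← consExp_tailExp m, ← coeff_headCoeff]
    rcases Nat.eq_zero_or_pos (m 0) with h | h
    · rw [h, h0]
      exact ih _ fun k hk => hm (k + 1) (by omega)
    · rw [hpos _ h, map_zero]

/-- Prepending a row of length `p` works because the only horizontal strip of that size in the new
diagram leaves exactly the old one. -/
theorem exists_consRow_preimage {K : Type*} [CommRing K] {v : YoungDiagram →₀ K} {p d : ℕ}
    (hv : ∀ π ∈ v.support, π.rowLen 0 ≤ p) (hd : ∀ π ∈ v.support, π.card + p ≤ d) :
    ∃ w : YoungDiagram →₀ K, hOp K p w = v ∧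
      ∀ π ∈ w.support, π.rowLen 0 ≤ p ∧ π.card ≤ d := by
  classical
  let f : YoungDiagram → YoungDiagram := fun σ =>
    if h : σ.rowLen 0 ≤ p then consRow p σ h else σ
  refine ⟨v.mapDomain f, ?_, fun π hπ => ?_⟩
  · rw [Finsupp.mapDomain, map_finsuppSum]
    conv_rhs => rw [← Finsupp.sum_single v]
    refine Finset.sum_congr rfl fun σ hσ => ?_
    have h1 : f σ = consRow p σ (hv σ hσ) := dif_pos _
    have h2 : hStrips p (f σ) = {σ} := by
      have h3 := hStrips_rowLen_zero (f σ)
      rwa [h1, rowLen_zero_consRow, tailRows_consRow, ← h1] at h3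
    dsimp only
    rw [← mul_one (v σ), ← smul_eq_mul, ← Finsupp.smul_single, ← Finsupp.smul_single, map_smul,
      stripOp_single, h2,
      Finset.sum_singleton]
  · obtain ⟨σ, hσ, rfl⟩ := Finset.mem_image.1 (Finsupp.mapDomain_support hπ)
    have h1 : f σ = consRow p σ (hv σ hσ) := dif_pos _
    have h2 := card_tailRows (f σ)
    rw [h1, rowLen_zero_consRow, tailRows_consRow] at h2
    have h3 := hd σ hσ
    rw [h1, rowLen_zero_consRow]
    omega

/-- Power series of bounded degree with the formal properties of symmetric functions are
combinations of Schur functions. -/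
theorem exists_schurMap_eq {K : Type*} [CommRing K] (M : Submodule K (MvPowerSeries ℕ K))
    (hrange : LinearMap.range (schurMap K) ≤ M) (hmem : ∀ k, ∀ F ∈ M, headCoeff K k F ∈ M)
    (hzero : ∀ F ∈ M, headCoeff K 0 F = F)
    (hcomm : ∀ p q, ∀ F ∈ M,
      headCoeff K p (headCoeff K q F) = headCoeff K q (headCoeff K p F))
    {F : MvPowerSeries ℕ K} (hF : F ∈ M) {d : ℕ}
    (hd : ∀ m : ℕ →₀ ℕ, d < m.degree → MvPowerSeries.coeff m F = 0) :
    ∃ v : YoungDiagram →₀ K, (∀ π ∈ v.support, π.card ≤ d) ∧ schurMap K v = F := by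
  induction d using Nat.strong_induction_on generalizing F with
  | _ d ih =>
    -- The inner induction is on a strict bound `p` for the exponents of x₀; degree bounds them by
    -- `d`, so `d + 1` is a valid start.
    suffices h : ∀ p, ∀ F ∈ M,
        (∀ m : ℕ →₀ ℕ, d < m.degree → MvPowerSeries.coeff m F = 0) →
        (∀ q, p ≤ q → headCoeff K q F = 0) →
        ∃ v : YoungDiagram →₀ K, (∀ π ∈ v.support, π.card ≤ d) ∧ schurMap K v = F by
      refine h (d + 1) F hF hd fun q hq => MvPowerSeries.ext fun m => ?_
      rw [coeff_headCoeff, hd, map_zero]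
      rw [degree_consExp]
      omega
    intro p
    induction p with
    | zero =>
      intro F hF _ hq
      refine ⟨0, by simp, ?_⟩
      rw [map_zero, ← hzero F hF, hq 0 le_rfl]
    | succ p ihp =>
      intro F hF hd hq
      rcases Nat.eq_zero_or_pos p with rfl | hp
      · refine ⟨Finsupp.single ⊥ (MvPowerSeries.coeff 0 F), fun π hπ => ?_, ?_⟩
        · classical
          rw [Finset.mem_singleton.1 (Finsupp.support_single_subset hπ)]
          simp [YoungDiagram.card]
        · have hS : schurMap K (Finsupp.single ⊥ (MvPowerSeries.coeff 0 F)) ∈ M :=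
            hrange (LinearMap.mem_range_self _ _)
          refine (sub_eq_zero.1 (eq_zero_of_headCoeff (hzero _ (M.sub_mem hF hS))
            (fun q hq0 => ?_) ?_)).symm
          · rw [map_sub, hq q hq0, headCoeff_schurMap, hOp_eq_zero, map_zero, sub_zero]
            intro π hπ
            rw [Finset.mem_singleton.1 (Finsupp.support_single_subset hπ), rowLen_bot]
            exact hq0
          · rw [map_sub, coeff_zero_schurMap, Finsupp.single_eq_same, sub_self]
      · by_cases hpd : d < p
        · refine ihp F hF hd fun q hpq => MvPowerSeries.ext fun m => ?_
          rw [coeff_headCoeff, hd, map_zero]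
          rw [degree_consExp]
          omega
        · obtain ⟨v, hv, hvF⟩ := ih (d - p) (by omega) (hmem p F hF) fun m hm => by
            rw [coeff_headCoeff, hd]
            rw [degree_consExp]
            omega
          -- The coefficient of x₀ ^ p has lower degree, hence is a Schur combination `v`. Since
          -- coefficient operators commute on `M`, larger ones kill it, so `v` has rows of length at
          -- most `p` and a row can be prepended.
          have hrow := rowLen_le_of_hOp_eq_zero (v := v) (p := p) fun q hpq =>
            schurMap_eq_zero (by
              rw [← headCoeff_schurMap, hvF, hcomm _ _ _ hF, hq q hpq, map_zero])
          obtain ⟨w, hw, hwsupp⟩ := exists_consRow_preimage hrow (d := d) fun π hπ => by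
            have := hv π hπ
            omega
          have hS : schurMap K w ∈ M := hrange (LinearMap.mem_range_self _ _)
          -- Subtracting the lifted combination cancels the coefficient of x₀ ^ p, which lowers the
          -- bound on exponents.
          obtain ⟨u, hu, huF⟩ := ihp (F - schurMap K w) (M.sub_mem hF hS) (fun m hm => by
              rw [map_sub, hd m hm, coeff_schurMap_of_lt_degree (fun π hπ => (hwsupp π hπ).2) hm,
                sub_zero]) fun q hpq => by
            rw [map_sub, headCoeff_schurMap]
            rcases hpq.eq_or_lt with rfl | hlt
            · rw [hw, hvF, sub_self]
            · rw [hq q hlt, hOp_eq_zero fun π hπ => (hwsupp π hπ).1.trans_lt hlt, map_zero,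
                sub_zero]
          refine ⟨u + w, fun π hπ => ?_, by rw [map_add, huF, sub_add_cancel]⟩
          classical
          rcases Finset.mem_union.1 (Finsupp.support_add hπ) with h | h
          · exact hu π h
          · exact (hwsupp π h).2

/-- Products of Schur functions are combinations of Schur functions. -/
theorem exists_schurMap_eq_mul {K : Type*} [CommRing K] (μ ν : YoungDiagram) :
    ∃ v : YoungDiagram →₀ K, schurMap K v = schur K μ * schur K ν := by
  have hmul : ∀ v w : YoungDiagram →₀ K, schurMap K v * schurMap K w ∈
      LinearMap.range (schurMap K) * LinearMap.range (schurMap K) := fun v w =>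
    Submodule.mul_mem_mul (LinearMap.mem_range_self _ _) (LinearMap.mem_range_self _ _)
  have hind : ∀ (P : MvPowerSeries ℕ K → Prop) (_ : ∀ v w, P (schurMap K v * schurMap K w))
      (_ : ∀ F G, P F → P G → P (F + G)),
      ∀ F ∈ LinearMap.range (schurMap K) * LinearMap.range (schurMap K), P F := by
    intro P h1 h2 F hF
    refine Submodule.mul_induction_on hF ?_ h2
    rintro _ ⟨v, rfl⟩ _ ⟨w, rfl⟩
    exact h1 v w
  -- The module `M` is the span of products of two Schur combinations; it contains the combinations
  -- themselves because `s_∅ = 1`.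
  refine (exists_schurMap_eq
    (LinearMap.range (schurMap K) * LinearMap.range (schurMap K)) ?_
    (fun k => hind _ (fun v w => ?_) fun F G hF hG => ?_)
    (hind _ (fun v w => ?_) fun F G hF hG => ?_)
    (fun p q => hind _ (fun v w => ?_) fun F G hF hG => ?_)
    (hmul (Finsupp.single μ 1) (Finsupp.single ν 1)) (d := μ.card + ν.card) ?_).imp fun v hv => by simpa using hv.2
  · rintro _ ⟨v, rfl⟩
    have h := hmul v (Finsupp.single ⊥ 1)
    rwa [schurMap_single, schur_bot, mul_one] at h
  · rw [headCoeff_mul]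
    refine Submodule.sum_mem _ fun x _ => ?_
    rw [headCoeff_schurMap, headCoeff_schurMap]
    exact hmul _ _
  · rw [map_add]
    exact Submodule.add_mem _ hF hG
  · simp [headCoeff_mul, headCoeff_schurMap, hOp_zero]
  · rw [map_add, hF, hG]
  · simp only [headCoeff_mul, headCoeff_schurMap, map_sum]
    rw [Finset.sum_comm]
    refine Finset.sum_congr rfl fun x _ => Finset.sum_congr rfl fun y _ => ?_
    rw [hOp_comm x.1, hOp_comm x.2]
  · simp only [map_add, hF, hG]
  · intro m hm
    classical
    rw [MvPowerSeries.coeff_mul]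
    refine Finset.sum_eq_zero fun x hx => ?_
    have hx' := congrArg Finsupp.degree (Finset.HasAntidiagonal.mem_antidiagonal.1 hx)
    rw [map_add] at hx'
    rw [schurMap_single, schurMap_single]
    by_cases h1 : x.1.degree = μ.card
    · rw [coeff_schur_of_degree_ne (π := ν) (by omega), mul_zero]
    · rw [coeff_schur_of_degree_ne h1, zero_mul]

/-! ### Extreme rows and columns in the expansion of a product. -/

/-- The expansion of `s_μ s_ν` in Schur functions. -/
noncomputable def schurMulExpansion (K : Type*) [CommRing K] (μ ν : YoungDiagram) :
    YoungDiagram →₀ K :=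
  (exists_schurMap_eq_mul μ ν).choose

theorem schurMap_schurMulExpansion {K : Type*} [CommRing K] (μ ν : YoungDiagram) :
    schurMap K (schurMulExpansion K μ ν) = schur K μ * schur K ν :=
  (exists_schurMap_eq_mul μ ν).choose_spec

theorem schurMulExpansion_comm {K : Type*} [CommRing K] (μ ν : YoungDiagram) :
    schurMulExpansion K μ ν = schurMulExpansion K ν μ :=
  schurMap_injective K (by simp only [schurMap_schurMulExpansion, mul_comm])

theorem schurMulExpansion_bot_left {K : Type*} [CommRing K] (ν : YoungDiagram) :
    schurMulExpansion K ⊥ ν = Finsupp.single ν 1 :=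
  schurMap_injective K (by
    rw [schurMap_schurMulExpansion, schurMap_single, schur_bot, one_mul])

theorem sum_stripOp_mul_eq_zero {K : Type*} [CommRing K] {s : ℕ → YoungDiagram → Finset YoungDiagram}
    {top : YoungDiagram → ℕ} (hlt : ∀ k π, top π < k → s k π = ∅) {μ ν : YoungDiagram} {k : ℕ}
    (hk : top μ + top ν < k) :
    ∑ x ∈ Finset.HasAntidiagonal.antidiagonal k,
      schurMap K (stripOp K (s x.1) (Finsupp.single μ 1)) *
        schurMap K (stripOp K (s x.2) (Finsupp.single ν 1)) = 0 := by
  refine Finset.sum_eq_zero fun x hx => ?_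
  have := Finset.HasAntidiagonal.mem_antidiagonal.1 hx
  by_cases h : top μ < x.1
  · simp [stripOp_single, hlt _ _ h]
  · simp [stripOp_single, hlt x.2 ν (by omega)]

/-- If two strip sizes add up to the sum of the maxima, either both are maximal or one is too large
and contributes zero. The form covers rows and columns alike. -/
theorem sum_stripOp_mul_top {K : Type*} [CommRing K] {s : ℕ → YoungDiagram → Finset YoungDiagram}
    {top : YoungDiagram → ℕ} {strip : YoungDiagram → YoungDiagram}
    (hlt : ∀ k π, top π < k → s k π = ∅) (heq : ∀ π, s (top π) π = {strip π})
    (μ ν : YoungDiagram) :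
    ∑ x ∈ Finset.HasAntidiagonal.antidiagonal (top μ + top ν),
      schurMap K (stripOp K (s x.1) (Finsupp.single μ 1)) *
        schurMap K (stripOp K (s x.2) (Finsupp.single ν 1)) =
      schur K (strip μ) * schur K (strip ν) := by
  rw [Finset.sum_eq_single (top μ, top ν)]
  · simp [stripOp_single, heq]
  · rintro ⟨i, j⟩ hx hne
    have hij := Finset.HasAntidiagonal.mem_antidiagonal.1 hx
    dsimp only at hij ⊢
    by_cases h : top μ < i
    · simp [stripOp_single, hlt _ _ h]
    · have h' : top ν < j := by
        by_contra h'
        exact hne (Prod.ext (by dsimp only; omega) (by dsimp only; omega))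
      simp [stripOp_single, hlt _ _ h']
  · intro h
    rw [Finset.HasAntidiagonal.mem_antidiagonal] at h
    exact absurd rfl h

theorem schurMap_hOp_schurMulExpansion {K : Type*} [CommRing K] (k : ℕ) (μ ν : YoungDiagram) :
    schurMap K (hOp K k (schurMulExpansion K μ ν)) =
      ∑ x ∈ Finset.HasAntidiagonal.antidiagonal k,
        schurMap K (hOp K x.1 (Finsupp.single μ 1)) *
          schurMap K (hOp K x.2 (Finsupp.single ν 1)) := by
  rw [← headCoeff_schurMap, schurMap_schurMulExpansion, ← schurMap_single, ← schurMap_single,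
    headCoeff_mul]
  simp only [headCoeff_schurMap]

theorem schurMap_eOp_schurMulExpansion {K : Type*} [CommRing K] (k : ℕ) (μ ν : YoungDiagram) :
    schurMap K (eOp K k (schurMulExpansion K μ ν)) =
      ∑ x ∈ Finset.HasAntidiagonal.antidiagonal k,
        schurMap K (eOp K x.1 (Finsupp.single μ 1)) *
          schurMap K (eOp K x.2 (Finsupp.single ν 1)) := by
  rw [← dualCoeff_schurMap, schurMap_schurMulExpansion, ← schurMap_single, ← schurMap_single,
    dualCoeff_mul]

theorem rowLen_le_of_mem_support_schurMulExpansion {K : Type*} [CommRing K] {μ ν : YoungDiagram} :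
    ∀ π ∈ (schurMulExpansion K μ ν).support, π.rowLen 0 ≤ μ.rowLen 0 + ν.rowLen 0 :=
  rowLen_le_of_hOp_eq_zero fun q hq => schurMap_eq_zero (by
    rw [schurMap_hOp_schurMulExpansion]
    exact sum_stripOp_mul_eq_zero (top := fun π => π.rowLen 0) (fun _ _ => hStrips_eq_empty) hq)

theorem colLen_le_of_mem_support_schurMulExpansion {K : Type*} [CommRing K] {μ ν : YoungDiagram} :
    ∀ π ∈ (schurMulExpansion K μ ν).support, π.colLen 0 ≤ μ.colLen 0 + ν.colLen 0 :=
  colLen_le_of_eOp_eq_zero fun q hq => schurMap_eq_zero (by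
    rw [schurMap_eOp_schurMulExpansion]
    exact sum_stripOp_mul_eq_zero (top := fun π => π.colLen 0) (fun _ _ => vStrips_eq_empty) hq)

theorem schurMulExpansion_apply_of_rowLen_lt {K : Type*} [CommRing K] {μ ν π : YoungDiagram}
    (h : μ.rowLen 0 + ν.rowLen 0 < π.rowLen 0) : schurMulExpansion K μ ν π = 0 := by
  by_contra hne
  have := rowLen_le_of_mem_support_schurMulExpansion π (Finsupp.mem_support_iff.2 hne)
  omega

theorem schurMulExpansion_apply_of_colLen_lt {K : Type*} [CommRing K] {μ ν π : YoungDiagram}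
    (h : μ.colLen 0 + ν.colLen 0 < π.colLen 0) : schurMulExpansion K μ ν π = 0 := by
  by_contra hne
  have := colLen_le_of_mem_support_schurMulExpansion π (Finsupp.mem_support_iff.2 hne)
  omega

/-- The largest horizontal strip operator applied to the product gives the product of the two
row-peeled Schur functions, and it transports the coefficient at π to `π.tailRows`. -/
theorem schurMulExpansion_apply_of_rowLen_eq {K : Type*} [CommRing K] {μ ν π : YoungDiagram}
    (h : π.rowLen 0 = μ.rowLen 0 + ν.rowLen 0) :
    schurMulExpansion K μ ν π = schurMulExpansion K μ.tailRows ν.tailRows π.tailRows := by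
  rw [← hOp_apply_tailRows rowLen_le_of_mem_support_schurMulExpansion h]
  congr 1
  refine schurMap_injective K ?_
  rw [schurMap_hOp_schurMulExpansion, schurMap_schurMulExpansion]
  exact sum_stripOp_mul_top (top := fun π => π.rowLen 0) (fun _ _ => hStrips_eq_empty)
    hStrips_rowLen_zero μ ν

theorem schurMulExpansion_apply_of_colLen_eq {K : Type*} [CommRing K] {μ ν π : YoungDiagram}
    (h : π.colLen 0 = μ.colLen 0 + ν.colLen 0) :
    schurMulExpansion K μ ν π = schurMulExpansion K μ.tailCols ν.tailCols π.tailCols := by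
  rw [← eOp_apply_tailCols colLen_le_of_mem_support_schurMulExpansion h]
  congr 1
  refine schurMap_injective K ?_
  rw [schurMap_eOp_schurMulExpansion, schurMap_schurMulExpansion]
  exact sum_stripOp_mul_top (top := fun π => π.colLen 0) (fun _ _ => vStrips_eq_empty)
    vStrips_colLen_zero μ ν

/-! ### Complementary pairs and the separating diagram. -/

/-- `μ` and `ν` are complementary in the `a × b` rectangle, in terms of row lengths. -/
structure IsComplementary (a b : ℕ) (μ ν : YoungDiagram) : Prop where
  add_eq : ∀ i j, i + j + 1 = a → μ.rowLen i + ν.rowLen j = b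
  left_zero : μ.rowLen a = 0
  right_zero : ν.rowLen a = 0

namespace IsComplementary

variable {a b : ℕ} {μ ν : YoungDiagram}

theorem eq_bot (h : IsComplementary a b μ ν) (hab : a = 0 ∨ b = 0) : μ = ⊥ ∧ ν = ⊥ := by
  have h1 : μ.rowLen 0 = 0 ∧ ν.rowLen 0 = 0 := by
    rcases Nat.eq_zero_or_pos a with rfl | ha
    · exact ⟨h.left_zero, h.right_zero⟩
    · have h1 := h.add_eq 0 (a - 1) (by omega)
      have h2 := h.add_eq (a - 1) 0 (by omega)
      omega
  constructor <;> refine ext_rowLen fun i => ?_ <;> rw [rowLen_bot]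
  · have := μ.rowLen_anti 0 i (Nat.zero_le i)
    omega
  · have := ν.rowLen_anti 0 i (Nat.zero_le i)
    omega

theorem rowLen_zero_le (h : IsComplementary a b μ ν) (ha : 0 < a) :
    μ.rowLen 0 ≤ b ∧ ν.rowLen 0 ≤ b := by
  have h1 := h.add_eq 0 (a - 1) (by omega)
  have h2 := h.add_eq (a - 1) 0 (by omega)
  omega

theorem colLen_zero_le (h : IsComplementary a b μ ν) : μ.colLen 0 ≤ a ∧ ν.colLen 0 ≤ a :=
  ⟨rowLen_eq_zero_iff.1 h.left_zero, rowLen_eq_zero_iff.1 h.right_zero⟩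

/-- A full first row in each diagram makes the last row of the other empty, so deleting both first
rows shortens the rectangle by two rows. -/
theorem tailRows (h : IsComplementary (a + 2) b μ ν) (hμ : μ.rowLen 0 = b)
    (hν : ν.rowLen 0 = b) : IsComplementary a b μ.tailRows ν.tailRows where
  add_eq i j hij := by
    rw [rowLen_tailRows, rowLen_tailRows]
    exact h.add_eq _ _ (by omega)
  left_zero := by
    have := h.add_eq (a + 1) 0 (by omega)
    rw [rowLen_tailRows]
    omega
  right_zero := by
    have := h.add_eq 0 (a + 1) (by omega)
    rw [rowLen_tailRows]
    omega

theorem tailCols (h : IsComplementary a (b + 2) μ ν) (hμ : μ.colLen 0 = a)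
    (hν : ν.colLen 0 = a) : IsComplementary a b μ.tailCols ν.tailCols where
  add_eq i j hij := by
    have h1 := h.add_eq i j hij
    have h2 : 0 < μ.rowLen i := rowLen_pos_iff.2 (by omega)
    have h3 : 0 < ν.rowLen j := rowLen_pos_iff.2 (by omega)
    rw [rowLen_tailCols, rowLen_tailCols]
    omega
  left_zero := by rw [rowLen_tailCols, h.left_zero]
  right_zero := by rw [rowLen_tailCols, h.right_zero]

theorem eq_bot_or_eq_bot (h : IsComplementary 1 1 μ ν) {β : YoungDiagram}
    (hβ : β.rowLen 0 = 1) (hβ' : β.rowLen 1 = 0) : (μ = ⊥ ∧ ν = β) ∨ (μ = β ∧ ν = ⊥) := by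
  have h0 := h.add_eq 0 0 rfl
  have key : ∀ {σ τ : YoungDiagram}, σ.rowLen 1 = 0 → τ.rowLen 1 = 0 →
      σ.rowLen 0 = τ.rowLen 0 → σ = τ := fun {σ τ} h1 h2 h3 => ext_rowLen fun i => by
    rcases Nat.eq_zero_or_pos i with rfl | hi
    · exact h3
    · have h4 := σ.rowLen_anti 1 i hi
      have h5 := τ.rowLen_anti 1 i hi
      omega
  rcases Nat.eq_zero_or_pos (μ.rowLen 0) with h1 | h1
  · exact Or.inl ⟨key h.left_zero (rowLen_bot 1) (h1.trans (rowLen_bot 0).symm),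
      key h.right_zero hβ' (by omega)⟩
  · exact Or.inr ⟨key h.left_zero hβ' (by omega),
      key h.right_zero (rowLen_bot 1) (by rw [rowLen_bot]; omega)⟩

end IsComplementary

theorem tailRows_eq_iff {μ ν : YoungDiagram} (h : μ.rowLen 0 = ν.rowLen 0) :
    μ.tailRows = ν.tailRows ↔ μ = ν :=
  ⟨eq_of_tailRows_eq h, fun h => by rw [h]⟩

theorem tailCols_eq_iff {μ ν : YoungDiagram} (h : μ.colLen 0 = ν.colLen 0) :
    μ.tailCols = ν.tailCols ↔ μ = ν :=
  ⟨eq_of_tailCols_eq h, fun h => by rw [h]⟩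

open Classical in
/-- Let `λ` and `κ` be complementary diagrams that differ by at most one box, in the middle row.
Then some `s_π` occurs in `s_λ s_κ`, with coefficient one, and in no other product of
complementary Schur functions. -/
theorem exists_separating_diagram (K : Type*) [CommRing K] {a b : ℕ} {lam kap : YoungDiagram}
    (h : IsComplementary a b lam kap) (hne : ∀ i, 2 * i + 1 ≠ a → lam.rowLen i = kap.rowLen i)
    (hmid : ∀ i, 2 * i + 1 = a →
      lam.rowLen i ≤ kap.rowLen i + 1 ∧ kap.rowLen i ≤ lam.rowLen i + 1) :
    ∃ π : YoungDiagram, π.rowLen 0 ≤ 2 * b ∧ π.colLen 0 ≤ 2 * a ∧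
      ∀ μ ν, IsComplementary a b μ ν → schurMulExpansion K μ ν π =
        if (μ = lam ∧ ν = kap) ∨ (μ = kap ∧ ν = lam) then 1 else 0 := by
  obtain ⟨n, hn⟩ : ∃ n, a + b = n := ⟨_, rfl⟩
  induction n using Nat.strong_induction_on generalizing a b lam kap with
  | _ n ih =>
    by_cases hab : a = 0 ∨ b = 0
    · obtain ⟨rfl, rfl⟩ := h.eq_bot hab
      refine ⟨⊥, by simp [rowLen_bot], by
        rw [rowLen_eq_zero_iff.1 (rowLen_bot 0) |> Nat.le_zero.1]; omega, fun μ ν hc => ?_⟩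
      obtain ⟨rfl, rfl⟩ := hc.eq_bot hab
      rw [schurMulExpansion_bot_left, if_pos (Or.inl ⟨rfl, rfl⟩), Finsupp.single_eq_same]
    push Not at hab
    have ha := Nat.pos_of_ne_zero hab.1
    have hb := Nat.pos_of_ne_zero hab.2
    by_cases h11 : a = 1 ∧ b = 1
    · obtain ⟨rfl, rfl⟩ := h11
      have hβ : (consRow 1 ⊥ (by simp [rowLen_bot])).rowLen 0 = 1 := rowLen_zero_consRow _
      have hβ' : (consRow 1 ⊥ (by simp [rowLen_bot])).rowLen 1 = 0 := by
        rw [← zero_add 1, rowLen_succ_consRow, rowLen_bot]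
      refine ⟨_, hβ.trans_le (by omega), (rowLen_eq_zero_iff.1 hβ').trans (by omega),
        fun μ ν hc => ?_⟩
      generalize consRow 1 ⊥ (by simp [rowLen_bot]) = β at hβ hβ'
      have h1 : schurMulExpansion K μ ν β = 1 := by
        rcases hc.eq_bot_or_eq_bot hβ hβ' with ⟨rfl, rfl⟩ | ⟨rfl, rfl⟩
        · rw [schurMulExpansion_bot_left, Finsupp.single_eq_same]
        · rw [schurMulExpansion_comm, schurMulExpansion_bot_left, Finsupp.single_eq_same]
      rw [h1, if_pos]
      rcases hc.eq_bot_or_eq_bot hβ hβ' with ⟨rfl, rfl⟩ | ⟨rfl, rfl⟩ <;>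
        rcases h.eq_bot_or_eq_bot hβ hβ' with ⟨rfl, rfl⟩ | ⟨rfl, rfl⟩ <;> simp
    by_cases hrow : lam.rowLen 0 = b
    · have ha2 : a ≠ 1 := by
        rintro rfl
        have h1 := h.add_eq 0 0 rfl
        have h2 := hmid 0 rfl
        omega
      obtain ⟨a, rfl⟩ : ∃ a', a = a' + 2 := ⟨a - 2, by omega⟩
      have hrow' : kap.rowLen 0 = b := by rw [← hne 0 (by omega), hrow]
      obtain ⟨π, hπ1, hπ2, hπ⟩ := ih (a + b) (by omega) (h.tailRows hrow hrow')
        (fun i hi => by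
          rw [rowLen_tailRows, rowLen_tailRows]
          exact hne _ (by omega))
        (fun i hi => by
          rw [rowLen_tailRows, rowLen_tailRows]
          exact hmid _ (by omega)) rfl
      refine ⟨consRow (2 * b) π hπ1, (rowLen_zero_consRow _).le, ?_, fun μ ν hc => ?_⟩
      · rw [← rowLen_eq_zero_iff, show 2 * (a + 2) = (2 * a + 3) + 1 by ring, rowLen_succ_consRow,
          rowLen_eq_zero_iff]
        omega
      · have hle := hc.rowLen_zero_le ha
        by_cases hfull : μ.rowLen 0 = b ∧ ν.rowLen 0 = b
        · obtain ⟨hμ, hν⟩ := hfull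
          rw [schurMulExpansion_apply_of_rowLen_eq (by rw [rowLen_zero_consRow]; omega),
            tailRows_consRow, hπ _ _ (hc.tailRows hμ hν), tailRows_eq_iff (by omega),
            tailRows_eq_iff (by omega), tailRows_eq_iff (by omega), tailRows_eq_iff (by omega)]
        -- One of the two first rows is not full, so they add up to less than `2 * b` and `s_π`
        -- cannot occur.
        · rw [schurMulExpansion_apply_of_rowLen_lt (by rw [rowLen_zero_consRow]; omega), if_neg]
          rintro (⟨rfl, rfl⟩ | ⟨rfl, rfl⟩)
          · exact hfull ⟨hrow, hrow'⟩
          · exact hfull ⟨hrow', hrow⟩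
    -- Since the first row of λ is not full, the last row of κ is nonempty; near equality makes the
    -- last row of λ nonempty too. Hence both first columns are full.
    · have hlast : 0 < lam.rowLen (a - 1) ∧ 0 < kap.rowLen (a - 1) ∧ 2 ≤ b := by
        have h1 := h.add_eq 0 (a - 1) (by omega)
        have h2 := h.add_eq (a - 1) 0 (by omega)
        have h3 := h.rowLen_zero_le ha
        by_cases ha1 : a = 1
        · subst ha1
          have h4 := hmid 0 rfl
          simp only [Nat.sub_self] at h1 h2 ⊢
          omega
        · have h4 := hne 0 (by omega)
          have h5 := hne (a - 1) (by omega)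
          have h6 := lam.rowLen_anti 0 (a - 1) (by omega)
          omega
      obtain ⟨b, rfl⟩ : ∃ b', b = b' + 2 := ⟨b - 2, by omega⟩
      have hcol : lam.colLen 0 = a := by
        have h1 := rowLen_pos_iff.1 hlast.1
        have h2 := h.colLen_zero_le
        omega
      have hcol' : kap.colLen 0 = a := by
        have h1 := rowLen_pos_iff.1 hlast.2.1
        have h2 := h.colLen_zero_le
        omega
      obtain ⟨π, hπ1, hπ2, hπ⟩ := ih (a + b) (by omega) (h.tailCols hcol hcol')
        (fun i hi => by
          rw [rowLen_tailCols, rowLen_tailCols, hne _ hi])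
        (fun i hi => by
          have := hmid i hi
          rw [rowLen_tailCols, rowLen_tailCols]
          omega) rfl
      refine ⟨consCol (2 * a) π hπ2, ?_, (colLen_zero_consCol _).le, fun μ ν hc => ?_⟩
      · rw [rowLen_consCol, if_pos (by omega)]
        omega
      · have hle := hc.colLen_zero_le
        by_cases hfull : μ.colLen 0 = a ∧ ν.colLen 0 = a
        · obtain ⟨hμ, hν⟩ := hfull
          rw [schurMulExpansion_apply_of_colLen_eq (by rw [colLen_zero_consCol]; omega),
            tailCols_consCol, hπ _ _ (hc.tailCols hμ hν), tailCols_eq_iff (by omega),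
            tailCols_eq_iff (by omega), tailCols_eq_iff (by omega), tailCols_eq_iff (by omega)]
        · rw [schurMulExpansion_apply_of_colLen_lt (by rw [colLen_zero_consCol]; omega), if_neg]
          rintro (⟨rfl, rfl⟩ | ⟨rfl, rfl⟩)
          · exact hfull ⟨hcol, hcol'⟩
          · exact hfull ⟨hcol', hcol⟩

/-! ### From complements in the rectangle to the main theorem. -/

theorem mem_complement {a b : ℕ} {μ : YoungDiagram} {i j : ℕ} :
    (i, j) ∈ complement a b μ ↔ (i < a ∧ j < b) ∧ (a - 1 - i, b - 1 - j) ∉ μ := by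
  rw [← mem_cells]
  simp [complement, rectangle]

theorem isComplementary_complement {a b : ℕ} {μ : YoungDiagram} (h : μ ≤ rectangle a b) :
    IsComplementary a b μ (complement a b μ) := by
  have hmem : ∀ {i j}, j < μ.rowLen i → i < a ∧ j < b := fun {i j} hx => by
    have h1 := (mem_cells _).2 (h (mem_iff_lt_rowLen.2 hx))
    simpa [rectangle] using h1
  refine ⟨fun i j hij => ?_, ?_, ?_⟩
  · have hle : μ.rowLen i ≤ b := by
      by_contra! hlt
      exact lt_irrefl _ (hmem hlt).2
    have key : ∀ k, k < (complement a b μ).rowLen j ↔ k < b - μ.rowLen i := fun k => by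
      rw [← mem_iff_lt_rowLen, mem_complement, mem_iff_lt_rowLen,
        show a - 1 - j = i by omega]
      omega
    have h1 := key (b - μ.rowLen i)
    have h2 := key ((complement a b μ).rowLen j)
    omega
  · by_contra hne
    exact lt_irrefl _ (hmem (Nat.pos_of_ne_zero hne)).1
  · by_contra hne
    have := mem_complement.1 (mem_iff_lt_rowLen.2 (Nat.pos_of_ne_zero hne))
    omega

theorem IsAlmostSelfComplementary.rowLen {a b : ℕ} {μ : YoungDiagram}
    (h : IsAlmostSelfComplementary a b μ) {i : ℕ} :
    (i ≠ a / 2 → μ.rowLen i = (complement a b μ).rowLen i) ∧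
      μ.rowLen i ≤ (complement a b μ).rowLen i + 1 ∧
      (complement a b μ).rowLen i ≤ μ.rowLen i + 1 := by
  have key : ∀ j, (i, j) ≠ (a / 2, b / 2) →
      (j < μ.rowLen i ↔ j < (complement a b μ).rowLen i) := fun j hj => by
    have h1 : (i, j) ∉ symmDiff μ.cells (complement a b μ).cells := by
      rw [h.2]
      simpa using hj
    rw [Finset.mem_symmDiff, mem_cells, mem_cells, mem_iff_lt_rowLen, mem_iff_lt_rowLen] at h1
    tauto
  generalize (complement a b μ).rowLen i = c at key ⊢
  refine ⟨fun hi => ?_, ?_⟩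
  · have h1 := key c (by simp [hi])
    have h2 := key (μ.rowLen i) (by simp [hi])
    omega
  · have h1 : ∀ j, j ≠ b / 2 → (j < μ.rowLen i ↔ j < c) := fun j hj => key j (by simp [hj])
    -- Two lengths that differ by two or more would disagree at two columns, one of them not
    -- central; testing next to each length detects this.
    have e1 := h1 c
    have e2 := h1 (c + 1)
    have e3 := h1 (μ.rowLen i)
    have e4 := h1 (μ.rowLen i + 1)
    omega

theorem schurOccurs_schurMap_iff {K : Type*} [CommRing K] {π : YoungDiagram}
    {v : YoungDiagram →₀ K} : SchurOccurs K π (schurMap K v) ↔ v π ≠ 0 := by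
  constructor
  · rintro ⟨c, hc, h⟩
    rwa [← schurMap_injective K (a₁ := c) hc]
  · exact fun h => ⟨v, rfl, h⟩

/-- If every member of a subfamily has a coordinate in which it alone among the family is nonzero,
then the subfamily is linearly independent of the others. -/
theorem linearlyIndependentOfOthers_of_coordinates {K : Type*} [CommRing K] {ι α M : Type*}
    [AddCommGroup M] [Module K M] (f : (α →₀ K) →ₗ[K] M) (hf : Function.Injective f)
    (w : ι → α →₀ K) {S P : Set ι} (hSP : S ⊆ P)
    (h : ∀ p ∈ S, ∃ x, w p x = 1 ∧ ∀ q ∈ P, q ≠ p → w q x = 0) :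
    LinearlyIndependentOfOthers K (fun q => f (w q)) S P := by
  have hlc : ∀ l : ι →₀ K, Finsupp.linearCombination K (fun q => f (w q)) l =
      f (Finsupp.linearCombination K w l) := fun l => by
    simp [Finsupp.linearCombination_apply, Finsupp.sum, map_sum]
  -- The coordinate `x` of any combination supported on `P` is the coefficient at `p`, so a linear
  -- relation determines that coefficient.
  have hcoord : ∀ p ∈ S, ∃ x, ∀ l ∈ Finsupp.supported K K P,
      Finsupp.linearCombination K w l x = l p := fun p hp => by
    obtain ⟨x, hx, hx0⟩ := h p hp
    refine ⟨x, fun l hl => ?_⟩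
    rw [Finsupp.linearCombination_apply, Finsupp.sum, Finsupp.finsetSum_apply,
      Finset.sum_eq_single p]
    · rw [Finsupp.smul_apply, hx, smul_eq_mul, mul_one]
    · intro q hq hne
      rw [Finsupp.smul_apply, hx0 q ((Finsupp.mem_supported K l).1 hl hq) hne, smul_zero]
    · intro hp
      rw [Finsupp.notMem_support_iff.1 hp, zero_smul, Finsupp.zero_apply]
  have key : ∀ l ∈ Finsupp.supported K K S, ∀ l' ∈ Finsupp.supported K K (P \ S),
      Finsupp.linearCombination K (fun q => f (w q)) l =
        Finsupp.linearCombination K (fun q => f (w q)) l' → l = 0 := by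
    intro l hl l' hl' heq
    rw [hlc, hlc] at heq
    refine Finsupp.ext fun p => ?_
    by_cases hp : p ∈ S
    · obtain ⟨x, hx⟩ := hcoord p hp
      rw [← hx l (Finsupp.supported_mono hSP hl), hf heq,
        hx l' (Finsupp.supported_mono Set.sdiff_subset hl'), Finsupp.zero_apply]
      by_contra hne
      exact ((Finsupp.mem_supported K l').1 hl' (Finsupp.mem_support_iff.2 hne)).2 hp
    · by_contra hne
      exact hp ((Finsupp.mem_supported K l).1 hl (Finsupp.mem_support_iff.2 hne))
  refine ⟨linearIndepOn_iff.2 fun l hl h0 => key l hl 0 (Submodule.zero_mem _) ?_, ?_⟩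
  · rw [h0, map_zero]
  · rw [Submodule.disjoint_def]
    intro y hy hy'
    obtain ⟨l, hl, rfl⟩ := (Finsupp.mem_span_image_iff_linearCombination K).1 hy
    obtain ⟨l', hl', heq⟩ := (Finsupp.mem_span_image_iff_linearCombination K).1 hy'
    rw [key l hl l' hl' heq.symm, map_zero]

/-- Common form of both parts of the theorem: only the near equality of row lengths matters for the
separating diagram. -/
theorem independent_and_occurs_of_near_self_complementary (K : Type*) [CommRing K] [Nontrivial K]
    {a b : ℕ} {S : Set (Sym2 YoungDiagram)}
    (hS : ∀ p ∈ S, ∃ μ ≤ rectangle a b, p = s(μ, complement a b μ) ∧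
      (∀ i, 2 * i + 1 ≠ a → μ.rowLen i = (complement a b μ).rowLen i) ∧
      ∀ i, 2 * i + 1 = a → μ.rowLen i ≤ (complement a b μ).rowLen i + 1 ∧
        (complement a b μ).rowLen i ≤ μ.rowLen i + 1) :
    LinearlyIndependentOfOthers K (schurProduct K) S (complementaryPairs a b) ∧
      ∀ p ∈ S, ∃ π : YoungDiagram, ∀ q ∈ complementaryPairs a b,
        (SchurOccurs K π (schurProduct K q) ↔ q = p) := by
  classical
  let w : Sym2 YoungDiagram → YoungDiagram →₀ K :=
    Sym2.lift ⟨schurMulExpansion K, schurMulExpansion_comm⟩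
  have hw : schurProduct K = fun q => schurMap K (w q) := funext fun q => by
    induction q using Sym2.ind with
    | _ μ ν => exact (schurMap_schurMulExpansion μ ν).symm
  have hSP : S ⊆ complementaryPairs a b := fun p hp => by
    obtain ⟨μ, h1, h2, -⟩ := hS p hp
    exact ⟨μ, h1, h2⟩
  have hsep : ∀ p ∈ S, ∃ π, ∀ q ∈ complementaryPairs a b, w q π = if q = p then 1 else 0 := by
    intro p hp
    obtain ⟨lam, hle, rfl, hne, hmid⟩ := hS p hp
    obtain ⟨π, -, -, hπ⟩ :=
      exists_separating_diagram K (isComplementary_complement hle) hne hmid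
    refine ⟨π, ?_⟩
    rintro _ ⟨μ, hμ, rfl⟩
    refine (hπ μ _ (isComplementary_complement hμ)).trans ?_
    simp only [Sym2.eq_iff]
  rw [hw]
  refine ⟨linearlyIndependentOfOthers_of_coordinates _ (schurMap_injective K) w hSP
    fun p hp => ?_, fun p hp => ?_⟩
  · obtain ⟨π, hπ⟩ := hsep p hp
    exact ⟨π, by rw [hπ p (hSP hp), if_pos rfl], fun q hq hne => by rw [hπ q hq, if_neg hne]⟩
  · obtain ⟨π, hπ⟩ := hsep p hp
    refine ⟨π, fun q hq => ?_⟩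
    rw [schurOccurs_schurMap_iff, hπ q hq]
    simp

theorem mainTheorem1 (K : Type*) [CommRing K] [IsDomain K] [CharZero K]
    (a b : ℕ) (ha : 0 < a) (hb : 0 < b) :
    (LinearlyIndependentOfOthers K (schurProduct K)
        (selfComplementaryPairs a b) (complementaryPairs a b) ∧
      ∀ p ∈ selfComplementaryPairs a b, ∃ π : YoungDiagram, ∀ q ∈ complementaryPairs a b,
        (SchurOccurs K π (schurProduct K q) ↔ q = p)) ∧
    (Odd a → Odd b →
      LinearlyIndependentOfOthers K (schurProduct K)
          (almostSelfComplementaryPairs a b) (complementaryPairs a b) ∧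
        ∀ p ∈ almostSelfComplementaryPairs a b, ∃ π : YoungDiagram,
          ∀ q ∈ complementaryPairs a b,
            (SchurOccurs K π (schurProduct K q) ↔ q = p)) := by
  refine ⟨independent_and_occurs_of_near_self_complementary K ?_,
    fun hodd _ => independent_and_occurs_of_near_self_complementary K ?_⟩
  · rintro _ ⟨μ, h, rfl⟩
    exact ⟨μ, h.1, rfl, fun i _ => by rw [h.2], fun i _ => by rw [h.2]; omega⟩
  · rintro _ ⟨μ, h, rfl⟩
    -- With `a = 2 * k + 1` the middle row is row `a / 2 = k`, the row of the central box.
    obtain ⟨k, rfl⟩ := hodd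
    exact ⟨μ, h.1, rfl, fun i hi => h.rowLen.1 (by omega), fun i _ => h.rowLen.2⟩
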